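/- **Conventions.** $\mathbb P^3,\mathbb P^2$ are complex projective spaces. A camera is a real $3\times4$ matrix $P$ of rank $3$; its center is its kernel, a point of $\mathbb P^3$. The cameras of a tuple always have distinct centers. A point $x\in\mathbb P^3$ has image $z\in\mathbb P^2$ under $P$ if $(x,z)$ lies in the closure of the graph of $x\mapsto P(x)$; so $z=P(x)$ unless $x$ is the center, and the center has every $z$ as an image. A configuration $(P_1,\dots,P_n,X)$, $X\subseteq\mathbb P^3$, is a reconstruction of $S\subseteq(\mathbb P^2)^n$ if every $x\in X$ has an image tuple in $S$ and every tuple in $S$ is an image tuple of some $x\in X$. The fundamental matrix $F_P^{ij}$ is defined up to scale by $$\mathbf x^TF_P^{ij}\mathbf y=\det\begin{bmatrix}P_i&\mathbf x&0\\P_j&0&\mathbf y\end{bmatrix}.$$ Two configurations $(P,X)$, $(Q,Y)$ are conjugate if they are reconstructions of the same set, there is no $H\in \mathrm{PGL}(4)$ with $H(X)=Y$ and $P_iH^{-1}=Q_i$ for all $i$, and $F_P^{ij}\ne F_Q^{ij}$ for all $i\neq j$. A configuration is critical if it has a conjugate. The set of critical points of $P$ with respect to $Q$ is the set of $x\in\mathbb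 P^3$ for which there is $y\in\mathbb P^3$ such that, for every $i$, some $z_i\in\mathbb P^2$ is an image of $x$ under $P_i$ and of $y$ under $Q_i$. The quadric $S_P^{ij}$ is $\{x: x^TP_i^TF_Q^{ij}P_jx=0\}$, and $S_Q^{ij}$ is obtained by exchanging $P$ and $Q$. A conic in a plane is the zero set in that plane of a nonzero quadratic form; it is smooth if the form is nondegenerate. **Proposition.** (1) Let $P=(P_1,P_2,P_3)$ and $Q=(Q_1,Q_2,Q_3)$ be triples of cameras such that the centers of $Q_1,Q_2,Q_3$ are not collinear, and suppose that the three quadrics $S_P^{12},S_P^{13},S_P^{23}$ are all equal to the same union $A\cup B$ of two distinct planes. Then the planes are real and, for a suitable labelling $\{A,B\}=\{\Pi,\Pi_C\}$, the set of critical points of $P$ with respect to $Q$ is $\Pi\cup C$, where $C\subset\Pi_C$ is a real conic passing through the three centers of $P$; $C$ is smooth if these centers are not collinear. The conjugate side is of the same type: the three quadrics $S_Q^{ij}$ are all equal to the same two distinct real planes $\Pi'\cup\Pi'_{C}$, and the set of critical points of $Q$ with respect to $P$ is $\Pi'\cup C'$, where $C'\subset\Pi'_C$ is a smooth real conic passing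 through the three centers of $Q$. (2) Conversely, let $n\ge2$ (in particular $n=3$), let $\Pi$ be a real plane, let $C$ be a smooth real conic in a real plane, and let $P=(P_1,\dots,P_n)$ be cameras with distinct centers, all lying on $C$. Then $(P,X)$ is a critical configuration for every $X\subseteq\Pi\cup C$. Moreover, there are cameras $Q=(Q_1,\dots,Q_n)$ with distinct centers, a real plane $\Pi'$ and a smooth real conic $C'$ through all centers of $Q$, with $C'\subset\Pi'$ if and only if $C\subset\Pi$, such that $(Q,\Pi'\cup C')$ is conjugate to $(P,\Pi\cup C)$, and for every $X\subseteq\Pi\cup C$ there is $Y\subseteq\Pi'\cup C'$ such that $(Q,Y)$ is conjugate to $(P,X)$. -/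

import Mathlib

open scoped LinearAlgebra.Projectivization Matrix

noncomputable section

/-- Projective space `ℙ³` over the complex numbers (the space points). -/
abbrev P3 : Type := ℙ ℂ (Fin 4 → ℂ)

/-- The projective plane `ℙ²` over the complex numbers (the image points). -/
abbrev P2 : Type := ℙ ℂ (Fin 3 → ℂ)

/-- A camera, given by its camera matrix: a real `3 × 4` matrix of full rank. -/
structure Camera where
  mat : Matrix (Fin 3) (Fin 4) ℝ
  rank_eq : mat.rank = 3

/-- The linear map `ℂ⁴ → ℂ³` given by the camera matrix. -/
def Camera.toLin (P : Camera) : (Fin 4 → ℂ) →ₗ[ℂ] (Fin 3 → ℂ) :=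
  (P.mat.map (algebraMap ℝ ℂ)).mulVecLin

theorem Camera.toLin_surjective (P : Camera) : Function.Surjective P.toLin := by
  have h1 : Function.Surjective P.mat.mulVecLin := by
    rw [← LinearMap.range_eq_top]
    apply Submodule.eq_top_of_finrank_eq
    have := P.rank_eq
    rw [Matrix.rank] at this
    rw [this]
    simp
  obtain ⟨B, hB⟩ := Matrix.mulVec_surjective_iff_exists_right_inverse.1 h1
  refine Matrix.mulVec_surjective_iff_exists_right_inverse.2
    ⟨B.map (algebraMap ℝ ℂ), ?_⟩
  rw [← Matrix.map_mul, hB]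
  exact Matrix.map_one _ (map_zero _) (map_one _)

theorem Camera.finrank_ker (P : Camera) :
    Module.finrank ℂ (LinearMap.ker P.toLin) = 1 := by
  have h := LinearMap.finrank_range_add_finrank_ker P.toLin
  rw [LinearMap.range_eq_top.2 P.toLin_surjective, finrank_top] at h
  simp only [Module.finrank_fintype_fun_eq_card, Fintype.card_fin] at h
  omega

/-- The camera center: the kernel of the camera matrix, as a point of `ℙ³`. -/
def Camera.center (P : Camera) : P3 :=
  Projectivization.mk'' (LinearMap.ker P.toLin) P.finrank_ker

/-- `z` is an image of `x` under the camera `P`. For `x` different from the camera center this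
says `z = P(x)`; the center has every `z` as an image, so that the relation is the closure of the
graph of `P : ℙ³ ⇢ ℙ²`. -/
def Camera.Sees (P : Camera) (x : P3) (z : P2) : Prop :=
  Submodule.map P.toLin x.submodule ≤ z.submodule

variable {n : ℕ}

/-- The camera centers of a tuple of cameras. -/
def centers (P : Fin n → Camera) : Fin n → P3 := fun i => (P i).center

/-- `(P₁, …, Pₙ, X)` is a reconstruction of the set `S ⊆ (ℙ²)ⁿ`: `S` is a set of images of the
points of `X`, each point of `X` having at least one image in `S`. -/
def IsReconstruction (P : Fin n → Camera) (X : Set P3) (S : Set (Fin n → P2)) : Prop :=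
  (∀ x ∈ X, ∃ s ∈ S, ∀ i, (P i).Sees x (s i)) ∧
  (∀ s ∈ S, ∃ x ∈ X, ∀ i, (P i).Sees x (s i))

/-- Equivalence of configurations: some `H ∈ PGL(4)` has `H(X) = Y` and `Pᵢ H⁻¹ = Qᵢ` for all `i`
(as projective maps). -/
def Equivalent (P : Fin n → Camera) (X : Set P3) (Q : Fin n → Camera) (Y : Set P3) : Prop :=
  ∃ H : (Fin 4 → ℂ) ≃ₗ[ℂ] (Fin 4 → ℂ),
    Projectivization.map H.toLinearMap H.injective '' X = Y ∧
    ∀ i, ∃ c : ℂ, c ≠ 0 ∧ (P i).toLin ∘ₗ H.symm.toLinearMap = c • (Q i).toLin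

/-- The `6 × 6` matrix with block rows `(P, x, 0)` and `(P', 0, y)`. -/
def fundamentalBlock (P P' : Camera) (x y : Fin 3 → ℝ) : Matrix (Fin 6) (Fin 6) ℝ :=
  (Matrix.fromBlocks P.mat (Matrix.of fun a => ![x a, 0])
    P'.mat (Matrix.of fun a => ![0, y a])).submatrix
    (finSumFinEquiv (m := 3) (n := 3)).symm (finSumFinEquiv (m := 4) (n := 2)).symm

/-- The fundamental matrix `F` of a pair of cameras: `xᵀ F y` is the determinant of the matrix with
block rows `(P, x, 0)` and `(P', 0, y)`, a bilinear form in `x` and `y`. -/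
def fundamentalMatrix (P P' : Camera) : Matrix (Fin 3) (Fin 3) ℝ :=
  Matrix.of fun a b => (fundamentalBlock P P' (Pi.single a 1) (Pi.single b 1)).det

/-- `F_P^{ij} ≠ F_Q^{ij}` for all `i ≠ j`, where fundamental matrices are taken up to scale. -/
def FundamentalMatricesDiffer (P Q : Fin n → Camera) : Prop :=
  ∀ i j, i ≠ j → ¬ ∃ c : ℝ, c ≠ 0 ∧
    fundamentalMatrix (Q i) (Q j) = c • fundamentalMatrix (P i) (P j)

/-- `(P, X)` and `(Q, Y)` are (non-trivially) conjugate configurations: inequivalent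
reconstructions of the same set of image points, with different fundamental matrices for every
pair of views. -/
def IsConjugate (P : Fin n → Camera) (X : Set P3) (Q : Fin n → Camera) (Y : Set P3) : Prop :=
  (∃ S : Set (Fin n → P2), IsReconstruction P X S ∧ IsReconstruction Q Y S) ∧
  ¬ Equivalent P X Q Y ∧ FundamentalMatricesDiffer P Q

/-- A (non-trivial) critical configuration: one that has a conjugate configuration. The centers of
the cameras of a configuration are always distinct. -/
def IsCritical (P : Fin n → Camera) (X : Set P3) : Prop :=
  ∃ (Q : Fin n → Camera) (Y : Set P3),
    Function.Injective (centers Q) ∧ IsConjugate P X Q Y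

/-- The set of critical points of `P` with respect to `Q`: the points `x` for which there is a `y`
with the same images in all views. -/
def criticalPoints (P Q : Fin n → Camera) : Set P3 :=
  {x | ∃ y : P3, ∃ z : Fin n → P2, ∀ i, (P i).Sees x (z i) ∧ (Q i).Sees y (z i)}

/-- The zero set in `ℙ³` of the linear form with coefficient vector `l`. -/
def planeLocus (l : Fin 4 → ℂ) : Set P3 := {x | ∀ u ∈ x.submodule, l ⬝ᵥ u = 0}

/-- The zero set in `ℙ³` of the quadratic form `u ↦ uᵀ N u`, for a real `4 × 4` matrix `N`. -/
def quadricLocus (N : Matrix (Fin 4) (Fin 4) ℝ) : Set P3 :=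
  {x | ∀ u ∈ x.submodule, u ⬝ᵥ (N.map (algebraMap ℝ ℂ) *ᵥ u) = 0}

/-- The quadric `S_P^{ij}` given by the matrix `Pᵢᵀ F_Q^{ij} Pⱼ`. -/
def viewQuadric (P Q : Fin n → Camera) (i j : Fin n) : Set P3 :=
  quadricLocus ((P i).matᵀ * fundamentalMatrix (Q i) (Q j) * (P j).mat)

/-- A real plane `m = 0` in `ℙ³` together with a real conic, the locus `K = 0` in a real plane
`l = 0`. The quadratic form `K` does not vanish identically on the plane `l = 0`. -/
structure PlaneConic where
  m : Fin 4 → ℝ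
  l : Fin 4 → ℝ
  K : Matrix (Fin 4) (Fin 4) ℝ
  m_ne : m ≠ 0
  l_ne : l ≠ 0
  K_symm : K.IsSymm
  K_ne : ∃ v, l ⬝ᵥ v = 0 ∧ v ⬝ᵥ (K *ᵥ v) ≠ 0

namespace PlaneConic

/-- The plane. -/
def plane (T : PlaneConic) : Set P3 := planeLocus fun k => (T.m k : ℂ)

/-- The plane of the conic. -/
def conicPlane (T : PlaneConic) : Set P3 := planeLocus fun k => (T.l k : ℂ)

/-- The conic. -/
def conic (T : PlaneConic) : Set P3 := T.conicPlane ∩ quadricLocus T.K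

/-- The union of the plane and the conic. -/
def carrier (T : PlaneConic) : Set P3 := T.plane ∪ T.conic

/-- The conic does not lie in the plane, i.e. the two planes are different. -/
def IsProper (T : PlaneConic) : Prop := LinearIndependent ℝ ![T.m, T.l]

/-- The conic is smooth (irreducible): `K` is nondegenerate on the plane `l = 0`. -/
def IsSmooth (T : PlaneConic) : Prop :=
  ∀ v, T.l ⬝ᵥ v = 0 → (∀ w, T.l ⬝ᵥ w = 0 → w ⬝ᵥ (T.K *ᵥ v) = 0) → v = 0

end PlaneConic

end

/-!
For the direct part, choose coordinates in which the centers of `Q` are coordinate points. The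
equations of the three quadrics are products of the same two linear forms, up to scalars, and
comparing factors around the odd cycle of the three views forces the third coordinates of the
images under all `P i` to vanish on one and the same of the two planes. The remaining equations then
say that `P i` and `Q i` are the restrictions to two hyperplanes of `ℙ⁴` of one and the same
projection `ℙ⁴ ⇢ ℙ²`, for three fixed projections centered at pairwise skew lines of the space
`ξ 4 = 0`. A point of the first hyperplane is critical if and only if it lies on the second one, or
lies in `ξ 4 = 0` on the quadric swept out by the common transversals of the three lines. This is
a plane and a conic, and the description is symmetric in `P` and `Q`.

For the converse, write the plane as `m = 0` and the conic as `K = 0`, let `k i` be the center of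
`P i` and `w i` the second point of the tangent to the conic at `k i` with `k i × w i = K k i`, and
put `Q i = P i * (1 + w i * mᵀ)`, for `m` suitably scaled. Then `Q i` agrees with `P i` on the
plane, and the points `x` of the conic have the same images as the points `y` with
`x × y = m(y) K x`, which run through a second conic.
-/

section RealVectors

variable {k m : ℕ}

/-- The inclusion of `ℝᵏ` into `ℂᵏ`. -/
noncomputable def complexify : (Fin k → ℝ) →ₗ[ℝ] (Fin k → ℂ) :=
  (Algebra.linearMap ℝ ℂ).compLeft (Fin k)

theorem complexify_apply (r : Fin k → ℝ) (j : Fin k) : complexify r j = (r j : ℂ) := rfl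

theorem complexify_injective : Function.Injective (complexify (k := k)) :=
  fun _ _ h => funext fun j => Complex.ofReal_injective (congrFun h j)

theorem complexify_eq_zero {r : Fin k → ℝ} : complexify r = 0 ↔ r = 0 :=
  map_eq_zero_iff _ complexify_injective

theorem complexify_smul (c : ℝ) (r : Fin k → ℝ) : complexify (c • r) = (c : ℂ) • complexify r := by
  rw [map_smul, Complex.coe_smul]

/-- The complex linear form with real coefficients `r`. -/
noncomputable def complexForm : (Fin k → ℝ) →ₗ[ℝ] Module.Dual ℂ (Fin k → ℂ) :=
  (dotProductBilin ℂ ℂ).restrictScalars ℝ ∘ₗ complexify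

theorem complexForm_apply (r : Fin k → ℝ) (u : Fin k → ℂ) :
    complexForm r u = complexify r ⬝ᵥ u := rfl

theorem complexForm_complexify (r s : Fin k → ℝ) :
    complexForm r (complexify s) = ((r ⬝ᵥ s : ℝ) : ℂ) := by
  simp [complexForm_apply, complexify_apply, dotProduct]

theorem complexForm_smul (c : ℝ) (r : Fin k → ℝ) :
    complexForm (c • r) = (c : ℂ) • complexForm r := by
  rw [map_smul, Complex.coe_smul]

theorem complexForm_injective : Function.Injective (complexForm (k := k)) := by
  refine (injective_iff_map_eq_zero _).2 fun r h => dotProduct_eq_zero r fun s => ?_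
  rw [← Complex.ofReal_eq_zero, ← complexForm_complexify, h, LinearMap.zero_apply]

theorem map_mulVec_apply (A : Matrix (Fin m) (Fin k) ℝ) (u : Fin k → ℂ) (j : Fin m) :
    (A.map (algebraMap ℝ ℂ) *ᵥ u) j = complexForm (A j) u := rfl

theorem map_mulVec_complexify (A : Matrix (Fin m) (Fin k) ℝ) (r : Fin k → ℝ) :
    A.map (algebraMap ℝ ℂ) *ᵥ complexify r = complexify (A *ᵥ r) :=
  funext fun j => complexForm_complexify (A j) r

end RealVectors

section Loci

theorem mk_mem_planeLocus {l u : Fin 4 → ℂ} (hu : u ≠ 0) :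
    Projectivization.mk ℂ u hu ∈ planeLocus l ↔ l ⬝ᵥ u = 0 := by
  simp only [planeLocus, Set.mem_ofPred_eq, Projectivization.submodule_mk]
  refine ⟨fun h => h u (Submodule.mem_span_singleton_self u), fun h v hv => ?_⟩
  obtain ⟨c, rfl⟩ := Submodule.mem_span_singleton.1 hv
  rw [dotProduct_smul, h, smul_zero]

theorem mk_mem_quadricLocus {N : Matrix (Fin 4) (Fin 4) ℝ} {u : Fin 4 → ℂ} (hu : u ≠ 0) :
    Projectivization.mk ℂ u hu ∈ quadricLocus N ↔
      u ⬝ᵥ (N.map (algebraMap ℝ ℂ) *ᵥ u) = 0 := by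
  simp only [quadricLocus, Set.mem_ofPred_eq, Projectivization.submodule_mk]
  refine ⟨fun h => h u (Submodule.mem_span_singleton_self u), fun h v hv => ?_⟩
  obtain ⟨c, rfl⟩ := Submodule.mem_span_singleton.1 hv
  rw [Matrix.mulVec_smul, smul_dotProduct, dotProduct_smul, h, smul_zero, smul_zero]

theorem PlaneConic.mk_mem_plane (T : PlaneConic) {u : Fin 4 → ℂ} (hu : u ≠ 0) :
    Projectivization.mk ℂ u hu ∈ T.plane ↔ complexForm T.m u = 0 :=
  mk_mem_planeLocus hu

theorem PlaneConic.mk_mem_conicPlane (T : PlaneConic) {u : Fin 4 → ℂ} (hu : u ≠ 0) :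
    Projectivization.mk ℂ u hu ∈ T.conicPlane ↔ complexForm T.l u = 0 :=
  mk_mem_planeLocus hu

theorem PlaneConic.mk_mem_conic (T : PlaneConic) {u : Fin 4 → ℂ} (hu : u ≠ 0) :
    Projectivization.mk ℂ u hu ∈ T.conic ↔
      complexForm T.l u = 0 ∧ u ⬝ᵥ (T.K.map (algebraMap ℝ ℂ) *ᵥ u) = 0 :=
  and_congr (T.mk_mem_conicPlane hu) (mk_mem_quadricLocus hu)

end Loci

namespace Camera

variable (P Q : Camera)

theorem toLin_complexify (r : Fin 4 → ℝ) : P.toLin (complexify r) = complexify (P.mat *ᵥ r) :=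
  map_mulVec_complexify P.mat r

theorem sees_mk_iff {u : Fin 4 → ℂ} (hu : u ≠ 0) {w : Fin 3 → ℂ} (hw : w ≠ 0) :
    P.Sees (Projectivization.mk ℂ u hu) (Projectivization.mk ℂ w hw) ↔
      ∃ c : ℂ, c • w = P.toLin u := by
  rw [Camera.Sees, Projectivization.submodule_mk, Projectivization.submodule_mk,
    Submodule.map_span, Set.image_singleton, Submodule.span_singleton_le_iff_mem,
    Submodule.mem_span_singleton]

theorem exists_common_image_iff {u v : Fin 4 → ℂ} (hu : u ≠ 0) (hv : v ≠ 0) :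
    (∃ z, P.Sees (Projectivization.mk ℂ u hu) z ∧ Q.Sees (Projectivization.mk ℂ v hv) z) ↔
      ¬ LinearIndependent ℂ ![P.toLin u, Q.toLin v] := by
  constructor
  · rintro ⟨z, hPz, hQz⟩ hli
    induction z using Projectivization.ind with
    | h w hw =>
      obtain ⟨c, hc⟩ := (P.sees_mk_iff hu hw).1 hPz
      obtain ⟨d, hd⟩ := (Q.sees_mk_iff hv hw).1 hQz
      obtain ⟨-, hc0⟩ := LinearIndependent.pair_iff.1 hli d (-c) (by rw [← hc, ← hd]; module)
      exact hli.ne_zero 0 (by simp [← hc, neg_eq_zero.1 hc0])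
  · intro hdep
    suffices ∃ w : Fin 3 → ℂ, w ≠ 0 ∧ (∃ c : ℂ, c • w = P.toLin u) ∧ ∃ c : ℂ, c • w = Q.toLin v by
      obtain ⟨w, hw, hPw, hQw⟩ := this
      exact ⟨_, (P.sees_mk_iff hu hw).2 hPw, (Q.sees_mk_iff hv hw).2 hQw⟩
    by_cases hP : P.toLin u = 0
    · by_cases hQ : Q.toLin v = 0
      · exact ⟨1, one_ne_zero, ⟨0, by rw [hP, zero_smul]⟩, ⟨0, by rw [hQ, zero_smul]⟩⟩
      · exact ⟨Q.toLin v, hQ, ⟨0, by rw [hP, zero_smul]⟩, ⟨1, one_smul ℂ _⟩⟩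
    · rw [LinearIndependent.pair_iff' hP] at hdep
      push Not at hdep
      exact ⟨P.toLin u, hP, ⟨1, one_smul ℂ _⟩, hdep⟩

theorem center_eq_mk_iff {u : Fin 4 → ℂ} (hu : u ≠ 0) :
    P.center = Projectivization.mk ℂ u hu ↔ P.toLin u = 0 := by
  rw [← Projectivization.submodule_injective.eq_iff, Camera.center,
    Projectivization.submodule_mk'', Projectivization.submodule_mk]
  constructor
  · intro h
    rw [← LinearMap.mem_ker, h]
    exact Submodule.mem_span_singleton_self u
  · intro h
    symm
    apply Submodule.eq_of_le_of_finrank_eq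
    · rwa [Submodule.span_singleton_le_iff_mem, LinearMap.mem_ker]
    · rw [P.finrank_ker, finrank_span_singleton hu]

theorem toLin_eq_zero_iff {u v : Fin 4 → ℂ} (hu : u ≠ 0) (h : P.toLin u = 0) :
    P.toLin v = 0 ↔ ∃ c : ℂ, v = c • u := by
  refine ⟨fun hv => ?_, fun ⟨c, hc⟩ => by rw [hc, map_smul, h, smul_zero]⟩
  by_cases hv0 : v = 0
  · exact ⟨0, by rw [hv0, zero_smul]⟩
  · have heq := ((P.center_eq_mk_iff hv0).2 hv).symm.trans ((P.center_eq_mk_iff hu).2 h)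
    obtain ⟨c, hc⟩ := (Projectivization.mk_eq_mk_iff' ..).1 heq
    exact ⟨c, hc.symm⟩

theorem exists_real_center : ∃ k : Fin 4 → ℝ, k ≠ 0 ∧ P.mat *ᵥ k = 0 := by
  have hdim := P.mat.mulVecLin.finrank_range_add_finrank_ker
  have hrank : Module.finrank ℝ (LinearMap.range P.mat.mulVecLin) = 3 := P.rank_eq
  simp only [hrank, Module.finrank_fintype_fun_eq_card, Fintype.card_fin] at hdim
  have hne : LinearMap.ker P.mat.mulVecLin ≠ ⊥ := by
    intro h
    rw [h, finrank_bot] at hdim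
    omega
  obtain ⟨k, hk, hk0⟩ := Submodule.exists_mem_ne_zero_of_ne_bot hne
  exact ⟨k, hk0, hk⟩

theorem center_eq_mk_complexify {k : Fin 4 → ℝ} (hk : k ≠ 0) (h : P.mat *ᵥ k = 0) :
    P.center = Projectivization.mk ℂ (complexify k) (complexify_eq_zero.not.2 hk) := by
  rw [center_eq_mk_iff, toLin_complexify, h, map_zero]

end Camera

section CommonImages

variable {n : ℕ} {P Q : Fin n → Camera}

/-- `x` and `y` have a common image tuple under the cameras `P` and `Q` respectively, so that
`criticalPoints P Q` is the set of `x` that have such a `y`. -/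
def HaveCommonImages (P Q : Fin n → Camera) (x y : P3) : Prop :=
  ∃ z : Fin n → P2, ∀ i, (P i).Sees x (z i) ∧ (Q i).Sees y (z i)

theorem haveCommonImages_mk_iff {u v : Fin 4 → ℂ} (hu : u ≠ 0) (hv : v ≠ 0) :
    HaveCommonImages P Q (Projectivization.mk ℂ u hu) (Projectivization.mk ℂ v hv) ↔
      ∀ i, ¬ LinearIndependent ℂ ![(P i).toLin u, (Q i).toLin v] := by
  simp only [HaveCommonImages, ← Camera.exists_common_image_iff _ _ hu hv, Classical.skolem]

theorem mk_mem_criticalPoints {u : Fin 4 → ℂ} (hu : u ≠ 0) :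
    Projectivization.mk ℂ u hu ∈ criticalPoints P Q ↔
      ∃ v ≠ 0, ∀ i, ¬ LinearIndependent ℂ ![(P i).toLin u, (Q i).toLin v] := by
  constructor
  · rintro ⟨y, hy⟩
    induction y using Projectivization.ind with
    | h v hv => exact ⟨v, hv, (haveCommonImages_mk_iff hu hv).1 hy⟩
  · rintro ⟨v, hv, h⟩
    exact ⟨_, (haveCommonImages_mk_iff hu hv).2 h⟩

end CommonImages

section FundamentalMatrix

theorem exists_eq_append_pair {α : Type*} (v : Fin 6 → α) :
    ∃ (w : Fin 4 → α) (s t : α), v = Fin.append w ![s, t] := by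
  refine ⟨fun j => v (Fin.castAdd 2 j), v 4, v 5, ?_⟩
  ext j
  fin_cases j <;> rfl

variable {R : Type*} [CommRing R]

/-- The `6 × 6` matrix with block rows `(A, x, 0)` and `(B, 0, y)`; `fundamentalBlock` is the case
of two real camera matrices. -/
def viewBlock (A B : Matrix (Fin 3) (Fin 4) R) (x y : Fin 3 → R) : Matrix (Fin 6) (Fin 6) R :=
  (Matrix.fromBlocks A (Matrix.of fun a => ![x a, 0])
    B (Matrix.of fun a => ![0, y a])).submatrix
    (finSumFinEquiv (m := 3) (n := 3)).symm (finSumFinEquiv (m := 4) (n := 2)).symm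

/-- The column of height six with upper half `p.1` and lower half `p.2`. -/
def stackedColumn : ((Fin 3 → R) × (Fin 3 → R)) →ₗ[R] (Fin 6 → R) :=
  LinearMap.funLeft R R (finSumFinEquiv (m := 3) (n := 3)).symm ∘ₗ
    (LinearEquiv.sumArrowLequivProdArrow (Fin 3) (Fin 3) R R).symm.toLinearMap

variable (A B : Matrix (Fin 3) (Fin 4) R)

theorem viewBlock_eq_updateCol_left (x y : Fin 3 → R) :
    viewBlock A B x y = (viewBlock A B 0 y).updateCol 4 (stackedColumn (x, 0)) := by
  ext i j
  fin_cases i <;> fin_cases j <;> rfl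

theorem viewBlock_eq_updateCol_right (x y : Fin 3 → R) :
    viewBlock A B x y = (viewBlock A B x 0).updateCol 5 (stackedColumn (0, y)) := by
  ext i j
  fin_cases i <;> fin_cases j <;> rfl

theorem det_viewBlock_left (x y : Fin 3 → R) :
    (viewBlock A B x y).det = (viewBlock A B 0 y).cramer (stackedColumn (x, 0)) 4 := by
  rw [Matrix.cramer_apply, ← viewBlock_eq_updateCol_left]

theorem det_viewBlock_right (x y : Fin 3 → R) :
    (viewBlock A B x y).det = (viewBlock A B x 0).cramer (stackedColumn (0, y)) 5 := by
  rw [Matrix.cramer_apply, ← viewBlock_eq_updateCol_right]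

/-- The determinant of `viewBlock A B x y` as a bilinear form in `x` and `y`. -/
def viewForm : (Fin 3 → R) →ₗ[R] (Fin 3 → R) →ₗ[R] R :=
  LinearMap.mk₂ R (fun x y => (viewBlock A B x y).det)
    (fun x x' y => by
      simp only [det_viewBlock_left A B _ y]
      rw [← Pi.add_apply, ← map_add, ← map_add, Prod.mk_add_mk, add_zero])
    (fun c x y => by
      simp only [det_viewBlock_left A B _ y]
      rw [← Pi.smul_apply, ← map_smul, ← map_smul, Prod.smul_mk, smul_zero])
    (fun x y y' => by
      simp only [det_viewBlock_right A B x]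
      rw [← Pi.add_apply, ← map_add, ← map_add, Prod.mk_add_mk, add_zero])
    (fun c x y => by
      simp only [det_viewBlock_right A B x]
      rw [← Pi.smul_apply, ← map_smul, ← map_smul, Prod.smul_mk, smul_zero])

theorem viewForm_apply (x y : Fin 3 → R) : viewForm A B x y = (viewBlock A B x y).det := rfl

theorem viewBlock_map {S : Type*} [CommRing S] (f : R →+* S) (x y : Fin 3 → R) :
    (viewBlock A B x y).map f = viewBlock (A.map f) (B.map f) (f ∘ x) (f ∘ y) := by
  ext i j
  fin_cases i <;> fin_cases j <;> first | rfl | exact map_zero f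

theorem viewBlock_mulVec_append (x y : Fin 3 → R) (w : Fin 4 → R) (s t : R) :
    viewBlock A B x y *ᵥ Fin.append w ![s, t] = stackedColumn (A *ᵥ w + s • x, B *ᵥ w + t • y) := by
  have happend : Fin.append w ![s, t] ∘ finSumFinEquiv = Sum.elim w ![s, t] := by
    ext (j | j)
    exacts [Fin.append_left w ![s, t] j, Fin.append_right w ![s, t] j]
  rw [viewBlock, Matrix.submatrix_mulVec_equiv, Equiv.symm_symm, happend, Matrix.fromBlocks_mulVec]
  refine congrArg (· ∘ _) (congrArg₂ Sum.elim (congrArg _ ?_) (congrArg _ ?_)) <;> ext i <;>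
    simp [Matrix.mulVec, dotProduct, mul_comm]

theorem append_pair_eq_zero_iff {w : Fin 4 → R} {s t : R} :
    Fin.append w ![s, t] = 0 ↔ w = 0 ∧ s = 0 ∧ t = 0 := by
  simp only [funext_iff, Fin.forall_fin_add (m := 4) (n := 2), Fin.append_left, Fin.append_right,
    Fin.forall_fin_two]
  rfl

theorem viewForm_eq_dotProduct_mulVec (x y : Fin 3 → R) :
    viewForm A B x y = x ⬝ᵥ (LinearMap.toMatrix₂' R (viewForm A B) *ᵥ y) := by
  rw [← Matrix.toLinearMap₂'_apply', Matrix.toLinearMap₂'_toMatrix']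

end FundamentalMatrix

/-- The epipolar constraint for image points `x` and `y` of the cameras `P` and `P'`: their viewing
rays meet. A vanishing scalar `s` or `t` means that the common point `w` is the corresponding
center; `w = 0` is allowed so that the constraint is bilinear also at `x = 0` and `y = 0`. -/
def RaysMeet (P P' : Camera) (x y : Fin 3 → ℂ) : Prop :=
  ∃ (w : Fin 4 → ℂ) (s t : ℂ), ¬ (w = 0 ∧ s = 0 ∧ t = 0) ∧ P.toLin w = s • x ∧ P'.toLin w = t • y

section Epipolar

variable (P P' : Camera)

theorem fundamentalBlock_eq_viewBlock (x y : Fin 3 → ℝ) :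
    fundamentalBlock P P' x y = viewBlock P.mat P'.mat x y := rfl

theorem map_fundamentalMatrix :
    (fundamentalMatrix P P').map (algebraMap ℝ ℂ) =
      LinearMap.toMatrix₂' ℂ
        (viewForm (P.mat.map (algebraMap ℝ ℂ)) (P'.mat.map (algebraMap ℝ ℂ))) := by
  have hsingle : ∀ a : Fin 3, algebraMap ℝ ℂ ∘ Pi.single a 1 = Pi.single a 1 := fun a => by
    ext j
    simp [Pi.single_apply, apply_ite]
  ext a b
  rw [LinearMap.toMatrix₂'_apply, viewForm_apply, Matrix.map_apply, fundamentalMatrix,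
    Matrix.of_apply, fundamentalBlock_eq_viewBlock, RingHom.map_det, RingHom.mapMatrix_apply,
    viewBlock_map, hsingle, hsingle]

theorem fundamentalMatrix_eq_zero_iff_raysMeet (x y : Fin 3 → ℂ) :
    x ⬝ᵥ ((fundamentalMatrix P P').map (algebraMap ℝ ℂ) *ᵥ y) = 0 ↔ RaysMeet P P' x y := by
  rw [map_fundamentalMatrix, ← viewForm_eq_dotProduct_mulVec, viewForm_apply,
    ← Matrix.exists_mulVec_eq_zero_iff]
  have hker : ∀ (w : Fin 4 → ℂ) (s t : ℂ),
      viewBlock (P.mat.map (algebraMap ℝ ℂ)) (P'.mat.map (algebraMap ℝ ℂ)) x y *ᵥ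
        Fin.append w ![-s, -t] = 0 ↔ P.toLin w = s • x ∧ P'.toLin w = t • y := fun w s t => by
    rw [viewBlock_mulVec_append, stackedColumn, LinearMap.comp_apply,
      map_eq_zero_iff _ (LinearMap.funLeft_injective_of_surjective _ _ _ (Equiv.surjective _)),
      LinearEquiv.coe_coe, map_eq_zero_iff _ (LinearEquiv.injective _), Prod.mk_eq_zero, neg_smul,
      neg_smul, ← sub_eq_add_neg, ← sub_eq_add_neg, sub_eq_zero, sub_eq_zero]
    rfl
  constructor
  · rintro ⟨v, hv, hzero⟩
    obtain ⟨w, s, t, rfl⟩ := exists_eq_append_pair v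
    refine ⟨w, -s, -t, ?_, (hker w (-s) (-t)).1 (by rwa [neg_neg, neg_neg])⟩
    rwa [neg_eq_zero, neg_eq_zero, ← append_pair_eq_zero_iff]
  · rintro ⟨w, s, t, hne, h⟩
    refine ⟨Fin.append w ![-s, -t], ?_, (hker w s t).2 h⟩
    rwa [Ne, append_pair_eq_zero_iff, neg_eq_zero, neg_eq_zero]

theorem RaysMeet.comm {x y : Fin 3 → ℂ} : RaysMeet P P' x y ↔ RaysMeet P' P y x := by
  constructor <;> rintro ⟨w, s, t, hne, hs, ht⟩ <;> exact ⟨w, t, s, by tauto, ht, hs⟩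

end Epipolar

section ViewQuadric

variable {n : ℕ} (P Q : Fin n → Camera) (i j : Fin n)

theorem mk_mem_viewQuadric {u : Fin 4 → ℂ} (hu : u ≠ 0) :
    Projectivization.mk ℂ u hu ∈ viewQuadric P Q i j ↔
      RaysMeet (Q i) (Q j) ((P i).toLin u) ((P j).toLin u) := by
  rw [viewQuadric, mk_mem_quadricLocus, ← fundamentalMatrix_eq_zero_iff_raysMeet, Matrix.map_mul,
    Matrix.map_mul, ← Matrix.mulVec_mulVec, ← Matrix.mulVec_mulVec, Matrix.transpose_map,
    Matrix.dotProduct_mulVec, Matrix.vecMul_transpose]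
  rfl

theorem viewQuadric_comm : viewQuadric P Q i j = viewQuadric P Q j i := by
  ext x
  induction x using Projectivization.ind with
  | h u hu => rw [mk_mem_viewQuadric, mk_mem_viewQuadric, RaysMeet.comm]

end ViewQuadric

section CrossProduct

theorem exists_smul_eq_of_crossProduct_eq_zero {F : Type*} [Field F] {x y : Fin 3 → F}
    (hx : x ≠ 0) (h : x ⨯₃ y = 0) : ∃ c : F, c • x = y := by
  by_contra! hc
  exact crossProduct_ne_zero_iff_linearIndependent.2 ((LinearIndependent.pair_iff' hx).2 hc) h

variable {R : Type*} [CommRing R]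

/-- The matrix of the linear map `y ↦ x ⨯₃ y`. -/
def crossMatrix (x : Fin 3 → R) : Matrix (Fin 3) (Fin 3) R :=
  !![0, -x 2, x 1; x 2, 0, -x 0; -x 1, x 0, 0]

theorem crossMatrix_mulVec (x y : Fin 3 → R) : crossMatrix x *ᵥ y = x ⨯₃ y := by
  ext j
  fin_cases j <;>
    simp [crossMatrix, cross_apply, Matrix.mulVec, dotProduct, Fin.sum_univ_three] <;> ring

theorem det_crossMatrix_sub_vecMulVec (x k m : Fin 3 → R) :
    (crossMatrix x - Matrix.vecMulVec k m).det = -((m ⬝ᵥ x) * (x ⬝ᵥ k)) := by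
  simp [crossMatrix, Matrix.det_fin_three, Matrix.vecMulVec_apply, Matrix.vec3_dotProduct]
  ring

theorem det_crossMatrix_add_smul (y : Fin 3 → R) (c : R) {K : Matrix (Fin 3) (Fin 3) R}
    (hK : K.IsSymm) :
    (crossMatrix y + c • K).det = c * (y ⬝ᵥ (K *ᵥ y) + c ^ 2 * K.det) := by
  simp [crossMatrix, Matrix.vec3_dotProduct, Matrix.mulVec, Matrix.det_fin_three, hK.apply 0 1,
    hK.apply 0 2, hK.apply 1 2]
  ring

theorem map_crossProduct {S : Type*} [CommRing S] (f : R →+* S) (x y : Fin 3 → R) :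
    (f ∘ x) ⨯₃ (f ∘ y) = f ∘ (x ⨯₃ y) := by
  ext j
  fin_cases j <;> simp [cross_apply]

theorem dotProduct_mulVec_comm {ι : Type*} [Fintype ι] {K : Matrix ι ι R} (hK : K.IsSymm)
    (x y : ι → R) : x ⬝ᵥ (K *ᵥ y) = y ⬝ᵥ (K *ᵥ x) := by
  rw [Matrix.dotProduct_mulVec, ← Matrix.mulVec_transpose, hK.eq, dotProduct_comm]

end CrossProduct

section PlaneConics

variable {F : Type*} [Field F] {K : Matrix (Fin 3) (Fin 3) F}

theorem crossProduct_eq_zero_of_isotropic (hK : K.IsSymm) (hdet : K.det ≠ 0) {c d : Fin 3 → F}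
    (hc : c ⬝ᵥ (K *ᵥ c) = 0) (hd : d ⬝ᵥ (K *ᵥ d) = 0) (hcd : c ⬝ᵥ (K *ᵥ d) = 0) :
    c ⨯₃ d = 0 := by
  refine dotProduct_eq_zero _ fun z => ?_
  rw [dotProduct_comm, triple_product_eq_det]
  set M : Matrix (Fin 3) (Fin 3) F := Matrix.of ![z, c, d]
  have hentry : ∀ i j, (M * K * Mᵀ) i j = ![z, c, d] i ⬝ᵥ (K *ᵥ ![z, c, d] j) := fun i j => by
    rw [Matrix.mul_assoc, Matrix.mul_apply_eq_vecMul, Matrix.dotProduct_mulVec,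
      ← Matrix.vecMul_vecMul]
    rfl
  have hgram : (M * K * Mᵀ).det = 0 := by
    rw [Matrix.det_fin_three]
    simp only [hentry]
    simp [hc, hd, hcd, dotProduct_mulVec_comm hK d c]
  rw [Matrix.det_mul, Matrix.det_mul, Matrix.det_transpose] at hgram
  exact (mul_eq_zero.1 hgram).elim (fun h => (mul_eq_zero.1 h).resolve_right hdet) id

theorem exists_crossProduct_eq_mulVec_of_isotropic {K : Matrix (Fin 3) (Fin 3) ℝ} {c : Fin 3 → ℝ}
    (hc : c ≠ 0) (h : c ⬝ᵥ (K *ᵥ c) = 0) : ∃ w, c ⨯₃ w = K *ᵥ c := by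
  have hcc : c ⬝ᵥ c ≠ 0 := dotProduct_self_eq_zero.not.2 hc
  refine ⟨(c ⬝ᵥ c)⁻¹ • ((K *ᵥ c) ⨯₃ c), ?_⟩
  rw [map_smul, inv_smul_eq_iff₀ hcc, cross_cross_eq_smul_sub_smul', dotProduct_comm (K *ᵥ c), h,
    zero_smul, sub_zero]

/-- The form `K + (det K) m mᵀ`, whose conic is matched with the conic of `K` by `ConicMatch`. -/
def twistedForm (K : Matrix (Fin 3) (Fin 3) F) (m : Fin 3 → F) : Matrix (Fin 3) (Fin 3) F :=
  K + K.det • Matrix.vecMulVec m m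

theorem dotProduct_twistedForm_mulVec (m y : Fin 3 → F) :
    y ⬝ᵥ (twistedForm K m *ᵥ y) = y ⬝ᵥ (K *ᵥ y) + (m ⬝ᵥ y) ^ 2 * K.det := by
  rw [twistedForm, Matrix.add_mulVec, Matrix.smul_mulVec, Matrix.vecMulVec_mulVec,
    op_smul_eq_smul, dotProduct_add, dotProduct_smul, dotProduct_smul, dotProduct_comm y m]
  simp only [smul_eq_mul]
  ring

/-- The relation `x × y = m(y) K x`. It is a bijection from the points `x` of the conic `K = 0` to
the points `y` of the conic of `twistedForm K m`. -/
def ConicMatch (K : Matrix (Fin 3) (Fin 3) F) (m x y : Fin 3 → F) : Prop :=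
  x ⨯₃ y = (m ⬝ᵥ y) • (K *ᵥ x)

namespace ConicMatch

variable {m x x' y : Fin 3 → F}

theorem exists_right (m : Fin 3 → F) (hx : x ⬝ᵥ (K *ᵥ x) = 0) :
    ∃ y, y ≠ 0 ∧ ConicMatch K m x y := by
  have hdet : (crossMatrix x - Matrix.vecMulVec (K *ᵥ x) m).det = 0 := by
    rw [det_crossMatrix_sub_vecMulVec, hx, mul_zero, neg_zero]
  obtain ⟨y, hy, h⟩ := Matrix.exists_mulVec_eq_zero_iff.2 hdet
  rw [Matrix.sub_mulVec, crossMatrix_mulVec, Matrix.vecMulVec_mulVec, op_smul_eq_smul,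
    sub_eq_zero] at h
  exact ⟨y, hy, h⟩

theorem iff_mulVec_eq_zero :
    ConicMatch K m x y ↔ (crossMatrix y + (m ⬝ᵥ y) • K) *ᵥ x = 0 := by
  rw [Matrix.add_mulVec, Matrix.smul_mulVec, crossMatrix_mulVec, ← cross_anticomm,
    neg_add_eq_zero]
  rfl

theorem exists_left (hK : K.IsSymm) (hy : y ⬝ᵥ (twistedForm K m *ᵥ y) = 0) :
    ∃ x, x ≠ 0 ∧ ConicMatch K m x y := by
  rw [dotProduct_twistedForm_mulVec] at hy
  have hdet : (crossMatrix y + (m ⬝ᵥ y) • K).det = 0 := by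
    rw [det_crossMatrix_add_smul y _ hK, hy, mul_zero]
  simpa only [iff_mulVec_eq_zero] using Matrix.exists_mulVec_eq_zero_iff.2 hdet

theorem isotropic_right (h : ConicMatch K m x y) (hK : K.IsSymm) (hx0 : x ≠ 0)
    (hx : x ⬝ᵥ (K *ᵥ x) = 0) : y ⬝ᵥ (twistedForm K m *ᵥ y) = 0 := by
  rw [dotProduct_twistedForm_mulVec]
  by_cases hm : m ⬝ᵥ y = 0
  · rw [ConicMatch, hm, zero_smul] at h
    obtain ⟨c, rfl⟩ := exists_smul_eq_of_crossProduct_eq_zero hx0 h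
    rw [hm, Matrix.mulVec_smul, smul_dotProduct, dotProduct_smul, hx]
    simp
  · have hdet := Matrix.exists_mulVec_eq_zero_iff.1 ⟨x, hx0, iff_mulVec_eq_zero.1 h⟩
    rw [det_crossMatrix_add_smul y _ hK] at hdet
    exact (mul_eq_zero.1 hdet).resolve_left hm

theorem isotropic_left (h : ConicMatch K m x y) (hy0 : y ≠ 0)
    (hy : y ⬝ᵥ (twistedForm K m *ᵥ y) = 0) : x ⬝ᵥ (K *ᵥ x) = 0 := by
  rw [dotProduct_twistedForm_mulVec] at hy
  by_cases hm : m ⬝ᵥ y = 0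
  · rw [ConicMatch, hm, zero_smul, ← cross_anticomm, neg_eq_zero] at h
    obtain ⟨c, rfl⟩ := exists_smul_eq_of_crossProduct_eq_zero hy0 h
    rw [hm, zero_pow two_ne_zero, zero_mul, add_zero] at hy
    rw [Matrix.mulVec_smul, smul_dotProduct, dotProduct_smul, hy, smul_zero, smul_zero]
  · have hdot := congrArg (x ⬝ᵥ ·) h
    simp only [dot_self_cross, dotProduct_smul, smul_eq_mul] at hdot
    exact (mul_eq_zero.1 hdot.symm).resolve_left hm

theorem crossProduct_left_eq_zero [NeZero (2 : F)] (h : ConicMatch K m x y)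
    (h' : ConicMatch K m x' y) (hK : K.IsSymm) (hdet : K.det ≠ 0) (hy : y ≠ 0)
    (hx : x ⬝ᵥ (K *ᵥ x) = 0) (hx' : x' ⬝ᵥ (K *ᵥ x') = 0) : x ⨯₃ x' = 0 := by
  by_contra hne
  have hpair : x ⬝ᵥ (K *ᵥ x') ≠ 0 := fun h0 =>
    hne (crossProduct_eq_zero_of_isotropic hK hdet hx hx' h0)
  have hm : m ⬝ᵥ y = 0 := by
    have hdot := congrArg (x' ⬝ᵥ ·) h
    have hdot' := congrArg (x ⬝ᵥ ·) h'
    simp only [dotProduct_smul, smul_eq_mul] at hdot hdot'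
    rw [triple_product_permutation, ← cross_anticomm, dotProduct_neg, hdot',
      dotProduct_mulVec_comm hK x' x] at hdot
    have htwo : 2 * (m ⬝ᵥ y) * (x ⬝ᵥ (K *ᵥ x')) = 0 := by linear_combination -hdot
    exact (mul_eq_zero.1 ((mul_eq_zero.1 htwo).resolve_right hpair)).resolve_left two_ne_zero
  rw [ConicMatch, hm, zero_smul, ← cross_anticomm, neg_eq_zero] at h h'
  obtain ⟨c, rfl⟩ := exists_smul_eq_of_crossProduct_eq_zero hy h
  obtain ⟨d, rfl⟩ := exists_smul_eq_of_crossProduct_eq_zero hy h'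
  exact hne (by rw [map_smul, map_smul, LinearMap.smul_apply, cross_self, smul_zero, smul_zero])

theorem det_tangent_eq_zero (h : ConicMatch K m x y) (hK : K.IsSymm) {c w : Fin 3 → F}
    (hcw : c ⨯₃ w = K *ᵥ c) : (Matrix.of ![c, x, y + (m ⬝ᵥ y) • w]).det = 0 := by
  refine (triple_product_eq_det c x _).symm.trans ?_
  rw [map_add, map_smul, h, dotProduct_add, dotProduct_smul, dotProduct_smul,
    triple_product_permutation, ← cross_anticomm, dotProduct_neg, hcw,
    dotProduct_mulVec_comm hK c x, smul_neg, add_neg_cancel]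

end ConicMatch

/-- The kernel of `1 + w mᵀ` modulo `c`: the vector `q` for which `q + m(q) w` is a multiple
of `c`. -/
def twistedCenter (m c w : Fin 3 → F) : Fin 3 → F := (1 + m ⬝ᵥ w) • c - (m ⬝ᵥ c) • w

variable {m c c' w w' : Fin 3 → F}

theorem dotProduct_twistedCenter : m ⬝ᵥ twistedCenter m c w = m ⬝ᵥ c := by
  rw [twistedCenter, dotProduct_sub, dotProduct_smul, dotProduct_smul, smul_eq_mul, smul_eq_mul]
  ring

theorem twistedCenter_add_smul :
    twistedCenter m c w + (m ⬝ᵥ twistedCenter m c w) • w = (1 + m ⬝ᵥ w) • c := by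
  rw [dotProduct_twistedCenter, twistedCenter, sub_add_cancel]

theorem twistedCenter_ne_zero (hc : c ≠ 0) (hmw : 1 + m ⬝ᵥ w ≠ 0) : twistedCenter m c w ≠ 0 := by
  intro h
  have := twistedCenter_add_smul (m := m) (c := c) (w := w)
  rw [h, dotProduct_zero, zero_smul, add_zero, eq_comm] at this
  exact smul_ne_zero hmw hc this

theorem conicMatch_twistedCenter (hcw : c ⨯₃ w = K *ᵥ c) :
    ConicMatch K (-m) c (twistedCenter m c w) := by
  rw [ConicMatch, neg_dotProduct, dotProduct_twistedCenter, twistedCenter, map_sub,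
    map_smul, map_smul, cross_self, smul_zero, zero_sub, hcw, neg_smul]

theorem eq_zero_of_smul_tangent_sub_eq [NeZero (2 : F)] (hK : K.IsSymm) (hcw : c ⨯₃ w = K *ᵥ c)
    (hcw' : c' ⨯₃ w' = K *ᵥ c') (hne : c ⬝ᵥ (K *ᵥ c') ≠ 0) {μ α β : F}
    (h : μ • (w - w') = α • c - β • c') : μ = 0 := by
  have hdot := congrArg (· ⬝ᵥ (c ⨯₃ c')) h
  simp only [smul_dotProduct, sub_dotProduct, dot_self_cross, dot_cross_self, smul_eq_mul,
    mul_zero, sub_zero] at hdot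
  have hw : w ⬝ᵥ (c ⨯₃ c') = -(c ⬝ᵥ (K *ᵥ c')) := by
    rw [triple_product_permutation, triple_product_permutation, ← cross_anticomm,
      dotProduct_neg, hcw, dotProduct_mulVec_comm hK]
  have hw' : w' ⬝ᵥ (c ⨯₃ c') = c ⬝ᵥ (K *ᵥ c') := by
    rw [triple_product_permutation, hcw']
  rw [hw, hw'] at hdot
  have htwo : 2 * μ * (c ⬝ᵥ (K *ᵥ c')) = 0 := by linear_combination -hdot
  exact (mul_eq_zero.1 ((mul_eq_zero.1 htwo).resolve_right hne)).resolve_left two_ne_zero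

end PlaneConics

section Conjugacy

variable {n : ℕ} {P Q : Fin n → Camera}

theorem RaysMeet.of_fundamentalMatrix_eq_smul {P P' Q Q' : Camera} {c : ℝ}
    (h : fundamentalMatrix Q Q' = c • fundamentalMatrix P P') {x y : Fin 3 → ℂ}
    (hxy : RaysMeet P P' x y) : RaysMeet Q Q' x y := by
  rw [← fundamentalMatrix_eq_zero_iff_raysMeet] at hxy ⊢
  have hmap : (fundamentalMatrix Q Q').map (algebraMap ℝ ℂ) =
      (c : ℂ) • (fundamentalMatrix P P').map (algebraMap ℝ ℂ) := by
    ext i j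
    simp [h]
  rw [hmap, Matrix.smul_mulVec, dotProduct_smul, hxy, smul_zero]

theorem Equivalent.raysMeet {X Y : Set P3} (h : Equivalent P X Q Y) {i j : Fin n}
    {x y : Fin 3 → ℂ} (hxy : RaysMeet (P i) (P j) x y) : RaysMeet (Q i) (Q j) x y := by
  obtain ⟨H, -, hH⟩ := h
  obtain ⟨w, s, t, hne, hs, ht⟩ := hxy
  obtain ⟨c, hc, hi⟩ := hH i
  obtain ⟨d, hd, hj⟩ := hH j
  refine ⟨H w, c⁻¹ * s, d⁻¹ * t, by simpa [hc, hd] using hne, ?_, ?_⟩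
  · rw [mul_smul, eq_inv_smul_iff₀ hc, ← LinearMap.smul_apply, ← hi, ← hs]
    simp
  · rw [mul_smul, eq_inv_smul_iff₀ hd, ← LinearMap.smul_apply, ← hj, ← ht]
    simp

theorem isConjugate_of_not_raysMeet (hn : 2 ≤ n)
    (hrays : ∀ i j, i ≠ j → ∃ x y, RaysMeet (P i) (P j) x y ∧ ¬ RaysMeet (Q i) (Q j) x y)
    {X Y : Set P3} (hS : ∃ S, IsReconstruction P X S ∧ IsReconstruction Q Y S) :
    IsConjugate P X Q Y := by
  refine ⟨hS, fun hequiv => ?_, ?_⟩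
  · obtain ⟨x, y, hP, hQ⟩ := hrays ⟨0, by omega⟩ ⟨1, by omega⟩ (by simp)
    exact hQ (hequiv.raysMeet hP)
  · rintro i j hij ⟨c, -, hc⟩
    obtain ⟨x, y, hP, hQ⟩ := hrays i j hij
    exact hQ (hP.of_fundamentalMatrix_eq_smul hc)

theorem exists_common_reconstruction {X Y : Set P3}
    (hX : ∀ x ∈ X, ∃ y ∈ Y, HaveCommonImages P Q x y)
    (hY : ∀ y ∈ Y, ∃ x ∈ X, HaveCommonImages P Q x y) :
    ∃ S, IsReconstruction P X S ∧ IsReconstruction Q Y S := by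
  refine ⟨{z | ∃ x ∈ X, ∃ y ∈ Y, ∀ i, (P i).Sees x (z i) ∧ (Q i).Sees y (z i)},
    ⟨fun x hx => ?_, ?_⟩, ⟨fun y hy => ?_, ?_⟩⟩
  · obtain ⟨y, hy, z, hz⟩ := hX x hx
    exact ⟨z, ⟨x, hx, y, hy, hz⟩, fun i => (hz i).1⟩
  · rintro z ⟨x, hx, y, -, hz⟩
    exact ⟨x, hx, fun i => (hz i).1⟩
  · obtain ⟨x, hx, z, hz⟩ := hY y hy
    exact ⟨z, ⟨x, hx, y, hy, hz⟩, fun i => (hz i).2⟩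
  · rintro z ⟨x, -, y, hy, hz⟩
    exact ⟨y, hy, fun i => (hz i).2⟩

theorem exists_subset_common_reconstruction {X Y : Set P3}
    (hX : ∀ x ∈ X, ∃ y ∈ Y, HaveCommonImages P Q x y) :
    ∃ Y' ⊆ Y, ∃ S, IsReconstruction P X S ∧ IsReconstruction Q Y' S := by
  refine ⟨{y ∈ Y | ∃ x ∈ X, HaveCommonImages P Q x y}, Set.sep_subset _ _,
    exists_common_reconstruction (fun x hx => ?_) fun y hy => hy.2⟩
  obtain ⟨y, hy, hxy⟩ := hX x hx
  exact ⟨y, ⟨hy, x, hx, hxy⟩, hxy⟩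

end Conjugacy

section PlaneCharts

open Matrix

/-- Coordinates on the plane `l = 0` in `R⁴`: the matrix `E` maps `R³` isomorphically onto the
plane, and `L`, which inverts `E`, together with `z` exhibits `E L = 1 - z lᵀ` as a projection onto
the plane. -/
structure PlaneChart {R : Type*} [CommRing R] (l : Fin 4 → R) where
  E : Matrix (Fin 4) (Fin 3) R
  L : Matrix (Fin 3) (Fin 4) R
  z : Fin 4 → R
  E_mul_L_add : E * L + vecMulVec z l = 1
  L_mul_E : L * E = 1
  vecMul_E : l ᵥ* E = 0

theorem transpose_mul_submatrix_succAbove_add {R : Type*} [CommRing R] (k : Fin 4) :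
    ((1 : Matrix (Fin 4) (Fin 4) R).submatrix k.succAbove id)ᵀ *
        (1 : Matrix (Fin 4) (Fin 4) R).submatrix k.succAbove id +
      vecMulVec (Pi.single k 1) (Pi.single k 1) = 1 := by
  ext i j
  rw [Matrix.add_apply, mul_apply, vecMulVec_apply]
  obtain hi | ⟨i, rfl⟩ := Fin.eq_self_or_eq_succAbove k i <;>
    obtain hj | ⟨j, rfl⟩ := Fin.eq_self_or_eq_succAbove k j <;>
      simp [*, one_apply, eq_comm]

namespace PlaneChart

theorem nonempty_of_ne_zero {F : Type*} [Field F] {l : Fin 4 → F} (hl : l ≠ 0) :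
    Nonempty (PlaneChart l) := by
  obtain ⟨k, hk⟩ := Function.ne_iff.1 hl
  rw [Pi.zero_apply] at hk
  let L : Matrix (Fin 3) (Fin 4) F := (1 : Matrix (Fin 4) (Fin 4) F).submatrix k.succAbove id
  let z : Fin 4 → F := (l k)⁻¹ • Pi.single k 1
  have hlz : l ⬝ᵥ z = 1 := by simp [z, hk]
  have hLz : L *ᵥ z = 0 := by
    ext j
    simp [L, z, mulVec, one_apply]
  have hLL : L * Lᵀ = 1 := by
    ext i j
    simp [L, mul_apply, one_apply]
  have hLL' : Lᵀ * L = 1 - vecMulVec z (l k • Pi.single k 1) := by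
    rw [eq_sub_iff_add_eq, ← transpose_mul_submatrix_succAbove_add k, smul_vecMulVec,
      vecMulVec_smul, smul_smul, inv_mul_cancel₀ hk, one_smul]
  refine ⟨⟨(1 - vecMulVec z l) * Lᵀ, L, z, ?_, ?_, ?_⟩⟩
  · rw [Matrix.mul_assoc, hLL', Matrix.sub_mul, Matrix.mul_sub, Matrix.mul_sub,
      vecMulVec_mul_vecMulVec, hlz]
    simp
  · rw [← Matrix.mul_assoc, Matrix.mul_sub, Matrix.mul_one, mul_vecMulVec, hLz]
    simp [hLL]
  · rw [← vecMul_vecMul, vecMul_sub, vecMul_one, vecMul_vecMulVec, hlz, one_smul, sub_self,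
      zero_vecMul]

section Ring

variable {R S : Type*} [CommRing R] [CommRing S] {l : Fin 4 → R} (χ : PlaneChart l)

theorem dotProduct_E_mulVec (ξ : Fin 3 → R) : l ⬝ᵥ (χ.E *ᵥ ξ) = 0 := by
  rw [dotProduct_mulVec, χ.vecMul_E, zero_dotProduct]

theorem E_mulVec_L_mulVec {v : Fin 4 → R} (hv : l ⬝ᵥ v = 0) : χ.E *ᵥ (χ.L *ᵥ v) = v := by
  have h := congrArg (· *ᵥ v) χ.E_mul_L_add
  simpa [add_mulVec, vecMulVec_mulVec, hv] using h

theorem E_mulVec_injective : Function.Injective (χ.E *ᵥ ·) :=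
  Function.LeftInverse.injective (g := (χ.L *ᵥ ·)) fun ξ => by
    simp only [mulVec_mulVec, χ.L_mul_E, one_mulVec]

/-- The matrix of the restriction to the plane of the quadratic form with matrix `K`. -/
def restrict (K : Matrix (Fin 4) (Fin 4) R) : Matrix (Fin 3) (Fin 3) R := χ.Eᵀ * K * χ.E

variable {K : Matrix (Fin 4) (Fin 4) R}

theorem dotProduct_restrict_mulVec (ξ η : Fin 3 → R) :
    ξ ⬝ᵥ (χ.restrict K *ᵥ η) = (χ.E *ᵥ ξ) ⬝ᵥ (K *ᵥ (χ.E *ᵥ η)) := by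
  rw [restrict, ← mulVec_mulVec, ← mulVec_mulVec, dotProduct_mulVec ξ, vecMul_transpose]

theorem isSymm_restrict (hK : K.IsSymm) : (χ.restrict K).IsSymm := by
  rw [IsSymm, restrict, transpose_mul, transpose_mul, hK.eq, transpose_transpose,
    Matrix.mul_assoc]

theorem restrict_add_det_smul (m : Fin 4 → R) :
    χ.restrict (K + (χ.restrict K).det • vecMulVec m m) =
      χ.restrict K + (χ.restrict K).det • vecMulVec (m ᵥ* χ.E) (m ᵥ* χ.E) := by
  rw [restrict, Matrix.mul_add, Matrix.add_mul, Matrix.mul_smul, Matrix.smul_mul,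
    mul_vecMulVec, vecMulVec_mul, mulVec_transpose]
  rfl

/-- Extension of scalars. -/
def map (f : R →+* S) : PlaneChart (f ∘ l) where
  E := χ.E.map f
  L := χ.L.map f
  z := f ∘ χ.z
  E_mul_L_add := by
    have hvec : vecMulVec (f ∘ χ.z) (f ∘ l) = (vecMulVec χ.z l).map f := by
      ext i j
      exact (map_mul f _ _).symm
    rw [hvec, ← Matrix.map_mul, ← Matrix.map_add _ (map_add f), χ.E_mul_L_add,
      Matrix.map_one _ (map_zero f) (map_one f)]
  L_mul_E := by rw [← Matrix.map_mul, χ.L_mul_E, Matrix.map_one _ (map_zero f) (map_one f)]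
  vecMul_E := funext fun j => by
    rw [← RingHom.map_vecMul, χ.vecMul_E]
    exact map_zero f

theorem restrict_map (f : R →+* S) : (χ.map f).restrict (K.map f) = (χ.restrict K).map f := by
  rw [restrict, restrict, Matrix.map_mul, Matrix.map_mul, transpose_map]
  rfl

end Ring

section Complex

variable {l : Fin 4 → ℝ} (χ : PlaneChart l)

/-- The parametrization of the points with complex coordinates of a real plane. -/
noncomputable def complexMap : (Fin 3 → ℂ) →ₗ[ℂ] (Fin 4 → ℂ) :=
  (χ.map (algebraMap ℝ ℂ)).E.mulVecLin

theorem complexMap_eq_zero {ξ : Fin 3 → ℂ} : χ.complexMap ξ = 0 ↔ ξ = 0 :=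
  map_eq_zero_iff χ.complexMap (χ.map (algebraMap ℝ ℂ)).E_mulVec_injective

theorem complexForm_complexMap_self (ξ : Fin 3 → ℂ) : complexForm l (χ.complexMap ξ) = 0 :=
  (χ.map (algebraMap ℝ ℂ)).dotProduct_E_mulVec ξ

theorem exists_complexMap_eq {u : Fin 4 → ℂ} (hu : complexForm l u = 0) :
    ∃ ξ, χ.complexMap ξ = u :=
  ⟨_, (χ.map (algebraMap ℝ ℂ)).E_mulVec_L_mulVec hu⟩

theorem complexForm_complexMap (m : Fin 4 → ℝ) (ξ : Fin 3 → ℂ) :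
    complexForm m (χ.complexMap ξ) = complexify (m ᵥ* χ.E) ⬝ᵥ ξ := by
  have hvec : complexify m ᵥ* (χ.map (algebraMap ℝ ℂ)).E = complexify (m ᵥ* χ.E) :=
    funext fun j => (RingHom.map_vecMul (algebraMap ℝ ℂ) χ.E m j).symm
  rw [← hvec, ← dotProduct_mulVec]
  rfl

theorem complexMap_complexify (r : Fin 3 → ℝ) :
    χ.complexMap (complexify r) = complexify (χ.E *ᵥ r) :=
  map_mulVec_complexify χ.E r

theorem complexMap_dotProduct_mulVec (K : Matrix (Fin 4) (Fin 4) ℝ) (ξ : Fin 3 → ℂ) :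
    χ.complexMap ξ ⬝ᵥ (K.map (algebraMap ℝ ℂ) *ᵥ χ.complexMap ξ) =
      ξ ⬝ᵥ ((χ.restrict K).map (algebraMap ℝ ℂ) *ᵥ ξ) := by
  rw [← restrict_map, dotProduct_restrict_mulVec]
  rfl

end Complex

end PlaneChart

theorem exists_dotProduct_mulVec_self_ne_zero {ι : Type*} [Fintype ι] {K : Matrix ι ι ℝ}
    (hK : K.IsSymm) {l v w : ι → ℝ} (hv : l ⬝ᵥ v = 0) (hw : l ⬝ᵥ w = 0)
    (hwv : w ⬝ᵥ (K *ᵥ v) ≠ 0) : ∃ v, l ⬝ᵥ v = 0 ∧ v ⬝ᵥ (K *ᵥ v) ≠ 0 := by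
  by_contra! hiso
  have hsum := hiso (v + w) (by rw [dotProduct_add, hv, hw, add_zero])
  rw [mulVec_add, dotProduct_add, add_dotProduct, add_dotProduct, hiso v hv, hiso w hw,
    dotProduct_mulVec_comm hK v w] at hsum
  exact hwv (by linarith)

theorem PlaneChart.exists_anisotropic_of_det_ne_zero {l : Fin 4 → ℝ}
    {K : Matrix (Fin 4) (Fin 4) ℝ} (hK : K.IsSymm) (χ : PlaneChart l)
    (hdet : (χ.restrict K).det ≠ 0) : ∃ v, l ⬝ᵥ v = 0 ∧ v ⬝ᵥ (K *ᵥ v) ≠ 0 := by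
  have hcol : χ.restrict K *ᵥ Pi.single 0 1 ≠ 0 := fun h =>
    hdet (exists_mulVec_eq_zero_iff.1 ⟨Pi.single 0 1, by simp, h⟩)
  obtain ⟨j, hj⟩ := Function.ne_iff.1 hcol
  rw [Pi.zero_apply, ← single_one_dotProduct j (χ.restrict K *ᵥ _),
    χ.dotProduct_restrict_mulVec] at hj
  exact exists_dotProduct_mulVec_self_ne_zero hK (χ.dotProduct_E_mulVec _)
    (χ.dotProduct_E_mulVec _) hj

theorem exists_dotProduct_ne_zero_and {ι : Type*} [Fintype ι] {l m : ι → ℝ} (hl : l ≠ 0)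
    (hm : m ≠ 0) : ∃ x, l ⬝ᵥ x ≠ 0 ∧ m ⬝ᵥ x ≠ 0 := by
  have hll : l ⬝ᵥ l ≠ 0 := dotProduct_self_eq_zero.not.2 hl
  have hmm : m ⬝ᵥ m ≠ 0 := dotProduct_self_eq_zero.not.2 hm
  by_cases hml : m ⬝ᵥ l = 0
  · refine ⟨l + m, ?_, ?_⟩
    · rwa [dotProduct_add, dotProduct_comm l m, hml, add_zero]
    · rwa [dotProduct_add, hml, zero_add]
  · exact ⟨l, hll, hml⟩

namespace PlaneConic

variable (T : PlaneConic)

theorem isSmooth_iff_det_ne_zero (χ : PlaneChart T.l) :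
    T.IsSmooth ↔ (χ.restrict T.K).det ≠ 0 := by
  constructor
  · intro hT hdet
    obtain ⟨ν, hν, hν0⟩ := exists_mulVec_eq_zero_iff.2 hdet
    refine hν (χ.E_mulVec_injective ((hT _ (χ.dotProduct_E_mulVec ν) fun w hw => ?_).trans
      (mulVec_zero _).symm))
    rw [← χ.E_mulVec_L_mulVec hw, ← χ.dotProduct_restrict_mulVec, hν0, dotProduct_zero]
  · intro hdet v hv hvw
    by_contra hv0
    refine hdet (exists_mulVec_eq_zero_iff.1 ⟨χ.L *ᵥ v, fun h => hv0 ?_, ?_⟩)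
    · rw [← χ.E_mulVec_L_mulVec hv, h, mulVec_zero]
    · refine dotProduct_eq_zero _ fun ξ => ?_
      rw [dotProduct_comm, χ.dotProduct_restrict_mulVec, χ.E_mulVec_L_mulVec hv]
      exact hvw _ (χ.dotProduct_E_mulVec ξ)

end PlaneConic

end PlaneCharts

section Twisting

open Matrix

variable {n : ℕ}

/-- The camera `P (1 + w mᵀ)`, which agrees with `P` on the plane `m = 0`. -/
def Camera.twist (P : Camera) (w m : Fin 4 → ℝ) (h : 1 + m ⬝ᵥ w ≠ 0) : Camera where
  mat := P.mat * (1 + vecMulVec w m)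
  rank_eq := by
    rw [rank_mul_eq_left_of_isUnit_det, P.rank_eq]
    rwa [vecMulVec_eq Unit, det_one_add_replicateCol_mul_replicateRow, isUnit_iff_ne_zero]

theorem Camera.toLin_twist (P : Camera) {w m : Fin 4 → ℝ} (h : 1 + m ⬝ᵥ w ≠ 0) (v : Fin 4 → ℂ) :
    (P.twist w m h).toLin v = P.toLin (v + complexForm m v • complexify w) := by
  have hmap : (1 + vecMulVec w m).map (algebraMap ℝ ℂ) =
      1 + vecMulVec (complexify w) (complexify m) := by
    rw [Matrix.map_add _ (map_add _), Matrix.map_one _ (map_zero _) (map_one _)]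
    congr 1
    ext i j
    exact map_mul (algebraMap ℝ ℂ) _ _
  have hmul : (P.mat * (1 + vecMulVec w m)).map (algebraMap ℝ ℂ) *ᵥ v =
      P.mat.map (algebraMap ℝ ℂ) *ᵥ (v + complexForm m v • complexify w) := by
    rw [Matrix.map_mul, hmap, ← mulVec_mulVec, add_mulVec, one_mulVec, vecMulVec_mulVec,
      op_smul_eq_smul]
    rfl
  exact hmul

/-- The data that twist the cameras `P`, with centers on the conic of `T`, along the tangents of
this conic: in a chart of its plane, the centers have coordinates `c i`, and `w i` is a second
point on the tangent at `c i`. The last two conditions say that the twisted cameras `Pᵢ (1 + wᵢ mᵀ)`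
have full rank and that the conic matched with that of `T` is smooth. -/
structure TangentTwist (P : Fin n → Camera) (T : PlaneConic) where
  chart : PlaneChart T.l
  c : Fin n → Fin 3 → ℝ
  w : Fin n → Fin 3 → ℝ
  c_ne_zero : ∀ i, c i ≠ 0
  mat_mulVec_c : ∀ i, (P i).mat *ᵥ (chart.E *ᵥ c i) = 0
  c_cross_w : ∀ i, c i ⨯₃ w i = chart.restrict T.K *ᵥ c i
  det_ne_zero : (chart.restrict T.K).det ≠ 0
  one_add_dotProduct_w_ne_zero : ∀ i, 1 + (T.m ᵥ* chart.E) ⬝ᵥ w i ≠ 0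
  det_twistedForm_ne_zero : (twistedForm (chart.restrict T.K) (T.m ᵥ* chart.E)).det ≠ 0

namespace TangentTwist

variable {P : Fin n → Camera} {T : PlaneConic} (D : TangentTwist P T)

/-- The matrix of the conic of `T` in the chart, over the complex numbers. -/
noncomputable def form : Matrix (Fin 3) (Fin 3) ℂ := (D.chart.restrict T.K).map (algebraMap ℝ ℂ)

/-- The equation of the plane of `T` in the chart, over the complex numbers. -/
noncomputable def line : Fin 3 → ℂ := complexify (T.m ᵥ* D.chart.E)

/-- The coordinates of the center of the camera `Pᵢ`, over the complex numbers. -/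
noncomputable def center (i : Fin n) : Fin 3 → ℂ := complexify (D.c i)

/-- The second point on the tangent at `D.center i`, over the complex numbers. -/
noncomputable def tangent (i : Fin n) : Fin 3 → ℂ := complexify (D.w i)

theorem form_isSymm : D.form.IsSymm := (D.chart.isSymm_restrict T.K_symm).map _

theorem det_form : D.form.det = ((D.chart.restrict T.K).det : ℂ) :=
  ((algebraMap ℝ ℂ).map_det (D.chart.restrict T.K)).symm

theorem det_form_ne_zero : D.form.det ≠ 0 := by
  rw [det_form]
  exact_mod_cast D.det_ne_zero

theorem center_ne_zero (i : Fin n) : D.center i ≠ 0 := complexify_eq_zero.not.2 (D.c_ne_zero i)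

theorem center_cross_tangent (i : Fin n) : D.center i ⨯₃ D.tangent i = D.form *ᵥ D.center i := by
  rw [form, center, map_mulVec_complexify, ← D.c_cross_w]
  exact map_crossProduct (algebraMap ℝ ℂ) _ _

theorem center_isotropic (i : Fin n) : D.center i ⬝ᵥ (D.form *ᵥ D.center i) = 0 := by
  rw [← center_cross_tangent, dot_self_cross]

theorem one_add_line_dotProduct_tangent_ne_zero (i : Fin n) :
    1 + D.line ⬝ᵥ D.tangent i ≠ 0 := by
  have h : D.line ⬝ᵥ D.tangent i = ((T.m ᵥ* D.chart.E ⬝ᵥ D.w i : ℝ) : ℂ) :=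
    complexForm_complexify (T.m ᵥ* D.chart.E) (D.w i)
  rw [h]
  exact_mod_cast D.one_add_dotProduct_w_ne_zero i

theorem toLin_center (i : Fin n) : (P i).toLin (D.chart.complexMap (D.center i)) = 0 := by
  rw [center, D.chart.complexMap_complexify, Camera.toLin_complexify, D.mat_mulVec_c, map_zero]

theorem complexMap_ne_zero {ξ : Fin 3 → ℂ} (hξ : ξ ≠ 0) : D.chart.complexMap ξ ≠ 0 :=
  D.chart.complexMap_eq_zero.not.2 hξ

theorem center_cross_center_ne_zero (hP : Function.Injective (centers P)) {i j : Fin n}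
    (hij : i ≠ j) : D.center i ⨯₃ D.center j ≠ 0 := by
  intro h
  obtain ⟨a, ha⟩ := exists_smul_eq_of_crossProduct_eq_zero (D.center_ne_zero i) h
  have hi := D.complexMap_ne_zero (D.center_ne_zero i)
  have hj := D.complexMap_ne_zero (D.center_ne_zero j)
  refine hij (hP ?_)
  rw [centers, centers, ((P i).center_eq_mk_iff hi).2 (D.toLin_center i),
    ((P j).center_eq_mk_iff hj).2 (D.toLin_center j), eq_comm, Projectivization.mk_eq_mk_iff']
  exact ⟨a, by rw [← map_smul, ha]⟩

theorem center_dotProduct_center_ne_zero (hP : Function.Injective (centers P)) {i j : Fin n}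
    (hij : i ≠ j) : D.center i ⬝ᵥ (D.form *ᵥ D.center j) ≠ 0 := fun h =>
  D.center_cross_center_ne_zero hP hij (crossProduct_eq_zero_of_isotropic D.form_isSymm
    D.det_form_ne_zero (D.center_isotropic i) (D.center_isotropic j) h)

/-- The twisted cameras `Pᵢ (1 + wᵢ mᵀ)`. -/
def cameras (i : Fin n) : Camera :=
  (P i).twist (D.chart.E *ᵥ D.w i) T.m (by
    rw [dotProduct_mulVec]
    exact D.one_add_dotProduct_w_ne_zero i)

theorem toLin_cameras (i : Fin n) (v : Fin 4 → ℂ) : (D.cameras i).toLin v =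
    (P i).toLin (v + complexForm T.m v • D.chart.complexMap (D.tangent i)) := by
  rw [cameras, Camera.toLin_twist, tangent, D.chart.complexMap_complexify]

theorem toLin_cameras_complexMap (i : Fin n) (η : Fin 3 → ℂ) :
    (D.cameras i).toLin (D.chart.complexMap η) =
      (P i).toLin (D.chart.complexMap (η + (D.line ⬝ᵥ η) • D.tangent i)) := by
  rw [toLin_cameras, D.chart.complexForm_complexMap, map_add D.chart.complexMap, map_smul, line]

theorem restrict_dual : D.chart.restrict
      (T.K + (D.chart.restrict T.K).det • vecMulVec T.m T.m) =
    twistedForm (D.chart.restrict T.K) (T.m ᵥ* D.chart.E) :=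
  D.chart.restrict_add_det_smul T.m

/-- The plane of `T` together with the conic matched by `ConicMatch` with the conic of `T`. -/
def dual : PlaneConic where
  m := T.m
  l := T.l
  K := T.K + (D.chart.restrict T.K).det • vecMulVec T.m T.m
  m_ne := T.m_ne
  l_ne := T.l_ne
  K_symm := T.K_symm.add (IsSymm.smul (transpose_vecMulVec _ _) _)
  K_ne := D.chart.exists_anisotropic_of_det_ne_zero
    (T.K_symm.add (IsSymm.smul (transpose_vecMulVec _ _) _))
    (D.restrict_dual ▸ D.det_twistedForm_ne_zero)

theorem dual_isSmooth : D.dual.IsSmooth :=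
  (D.dual.isSmooth_iff_det_ne_zero D.chart).2 (D.restrict_dual ▸ D.det_twistedForm_ne_zero)

theorem mk_complexMap_mem_conic {ξ : Fin 3 → ℂ} (hξ : D.chart.complexMap ξ ≠ 0) :
    Projectivization.mk ℂ _ hξ ∈ T.conic ↔ ξ ⬝ᵥ (D.form *ᵥ ξ) = 0 := by
  rw [T.mk_mem_conic, D.chart.complexMap_dotProduct_mulVec, form,
    and_iff_right (D.chart.complexForm_complexMap_self ξ)]

theorem mk_complexMap_mem_dual_conic {η : Fin 3 → ℂ} (hη : D.chart.complexMap η ≠ 0) :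
    Projectivization.mk ℂ _ hη ∈ D.dual.conic ↔
      η ⬝ᵥ (twistedForm D.form D.line *ᵥ η) = 0 := by
  have hmap : (twistedForm (D.chart.restrict T.K) (T.m ᵥ* D.chart.E)).map (algebraMap ℝ ℂ) =
      twistedForm D.form D.line := by
    rw [twistedForm, twistedForm, det_form]
    ext i j
    simp [form, vecMulVec_apply, line, complexify_apply]
  rw [D.dual.mk_mem_conic, D.chart.complexMap_dotProduct_mulVec, dual, restrict_dual, hmap,
    and_iff_right (D.chart.complexForm_complexMap_self η)]

section Correspondence

variable {ξ η : Fin 3 → ℂ}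

theorem haveCommonImages_of_conicMatch (h : ConicMatch D.form D.line ξ η)
    (hξ : D.chart.complexMap ξ ≠ 0) (hη : D.chart.complexMap η ≠ 0) :
    HaveCommonImages P D.cameras (Projectivization.mk ℂ _ hξ) (Projectivization.mk ℂ _ hη) := by
  refine (haveCommonImages_mk_iff hξ hη).2 fun i hli => ?_
  obtain ⟨v, hv, hv0⟩ := exists_vecMul_eq_zero_iff.2
    (h.det_tangent_eq_zero D.form_isSymm (D.center_cross_tangent i))
  have hsum : v 0 • D.center i + v 1 • ξ + v 2 • (η + (D.line ⬝ᵥ η) • D.tangent i) = 0 := by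
    rw [← hv0, vecMul_eq_sum, Fin.sum_univ_three]
    rfl
  have himage := congrArg (fun ζ => (P i).toLin (D.chart.complexMap ζ)) hsum
  simp only [map_add, map_smul, map_zero, toLin_center, smul_zero, zero_add] at himage
  obtain ⟨h1, h2⟩ := LinearIndependent.pair_iff.1 hli (v 1) (v 2) (by
    rw [toLin_cameras_complexMap, ← himage]
    simp only [map_add, map_smul])
  rw [h1, h2, zero_smul, zero_smul, add_zero, add_zero] at hsum
  have h0 := (smul_eq_zero.1 hsum).resolve_right (D.center_ne_zero i)
  exact hv (funext fun j => by fin_cases j <;> assumption)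

theorem haveCommonImages_of_mem_plane {x : P3} (hx : x ∈ T.plane) :
    HaveCommonImages P D.cameras x x := by
  induction x using Projectivization.ind with
  | h u hu =>
    refine (haveCommonImages_mk_iff hu hu).2 fun i hli => ?_
    rw [D.toLin_cameras, (T.mk_mem_plane hu).1 hx, zero_smul, add_zero] at hli
    exact zero_ne_one (hli.injective (a₁ := 0) (a₂ := 1) rfl)

theorem exists_mem_dual_carrier {x : P3} (hx : x ∈ T.carrier) :
    ∃ y ∈ D.dual.carrier, HaveCommonImages P D.cameras x y := by
  rcases hx with hx | hx
  · exact ⟨x, Or.inl hx, D.haveCommonImages_of_mem_plane hx⟩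
  · induction x using Projectivization.ind with
    | h u hu =>
      obtain ⟨ξ, rfl⟩ := D.chart.exists_complexMap_eq ((T.mk_mem_conic hu).1 hx).1
      have hξ : ξ ≠ 0 := D.chart.complexMap_eq_zero.not.1 hu
      rw [D.mk_complexMap_mem_conic] at hx
      obtain ⟨η, hη, hmatch⟩ := ConicMatch.exists_right D.line hx
      exact ⟨_, Or.inr ((D.mk_complexMap_mem_dual_conic (D.complexMap_ne_zero hη)).2
        (hmatch.isotropic_right D.form_isSymm hξ hx)), D.haveCommonImages_of_conicMatch hmatch hu _⟩

theorem exists_mem_carrier {y : P3} (hy : y ∈ D.dual.carrier) :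
    ∃ x ∈ T.carrier, HaveCommonImages P D.cameras x y := by
  rcases hy with hy | hy
  · exact ⟨y, Or.inl hy, D.haveCommonImages_of_mem_plane hy⟩
  · induction y using Projectivization.ind with
    | h v hv =>
      obtain ⟨η, rfl⟩ := D.chart.exists_complexMap_eq ((D.dual.mk_mem_conic hv).1 hy).1
      have hη : η ≠ 0 := D.chart.complexMap_eq_zero.not.1 hv
      rw [D.mk_complexMap_mem_dual_conic] at hy
      obtain ⟨ξ, hξ, hmatch⟩ := ConicMatch.exists_left D.form_isSymm hy
      exact ⟨_, Or.inr ((D.mk_complexMap_mem_conic (D.complexMap_ne_zero hξ)).2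
        (hmatch.isotropic_left hη hy)), D.haveCommonImages_of_conicMatch hmatch _ hv⟩

end Correspondence

section Centers

/-- The coordinates of the center of the twisted camera `D.cameras i`. -/
noncomputable def dualCenter (i : Fin n) : Fin 3 → ℂ :=
  twistedCenter D.line (D.center i) (D.tangent i)

theorem dualCenter_ne_zero (i : Fin n) : D.dualCenter i ≠ 0 :=
  twistedCenter_ne_zero (D.center_ne_zero i) (D.one_add_line_dotProduct_tangent_ne_zero i)

theorem conicMatch_dualCenter (i : Fin n) :
    ConicMatch D.form (-D.line) (D.center i) (D.dualCenter i) :=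
  conicMatch_twistedCenter (D.center_cross_tangent i)

theorem centers_cameras (i : Fin n) : centers D.cameras i =
    Projectivization.mk ℂ _ (D.complexMap_ne_zero (D.dualCenter_ne_zero i)) := by
  rw [centers, Camera.center_eq_mk_iff, toLin_cameras_complexMap, dualCenter,
    twistedCenter_add_smul, map_smul, map_smul, D.toLin_center, smul_zero]

theorem centers_cameras_mem_conic (i : Fin n) : centers D.cameras i ∈ D.dual.conic := by
  have hmem := (D.conicMatch_dualCenter i).isotropic_right D.form_isSymm (D.center_ne_zero i)
    (D.center_isotropic i)
  rw [centers_cameras, mk_complexMap_mem_dual_conic]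
  rwa [dotProduct_twistedForm_mulVec, neg_dotProduct, neg_sq,
    ← dotProduct_twistedForm_mulVec] at hmem

theorem centers_cameras_injective (hP : Function.Injective (centers P)) :
    Function.Injective (centers D.cameras) := by
  intro i j hij
  by_contra hne
  rw [centers_cameras, centers_cameras, Projectivization.mk_eq_mk_iff'] at hij
  obtain ⟨a, ha⟩ := hij
  rw [← map_smul, ← sub_eq_zero, ← map_sub, D.chart.complexMap_eq_zero, sub_eq_zero] at ha
  have hmatch : ConicMatch D.form (-D.line) (D.center j) (D.dualCenter i) := by
    rw [← ha, ConicMatch, map_smul, D.conicMatch_dualCenter j, dotProduct_smul, smul_smul,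
      smul_eq_mul]
  exact D.center_cross_center_ne_zero hP hne ((D.conicMatch_dualCenter i).crossProduct_left_eq_zero
    hmatch D.form_isSymm D.det_form_ne_zero (D.dualCenter_ne_zero i) (D.center_isotropic i)
    (D.center_isotropic j))

end Centers

section Rays

theorem exists_smul_center_of_toLin_cameras_eq {i : Fin n} {u v : Fin 4 → ℂ} {s : ℂ}
    (h : (D.cameras i).toLin v = s • (P i).toLin u) :
    ∃ α : ℂ, v + complexForm T.m v • D.chart.complexMap (D.tangent i) - s • u =
      α • D.chart.complexMap (D.center i) := by
  refine ((P i).toLin_eq_zero_iff (D.complexMap_ne_zero (D.center_ne_zero i))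
    (D.toLin_center i)).1 ?_
  rw [map_sub, ← toLin_cameras, h, map_smul, sub_self]

theorem not_raysMeet_cameras (hP : Function.Injective (centers P)) {i j : Fin n} (hij : i ≠ j)
    {u : Fin 4 → ℂ} (hl : complexForm T.l u ≠ 0) (hm : complexForm T.m u ≠ 0) :
    ¬ RaysMeet (D.cameras i) (D.cameras j) ((P i).toLin u) ((P j).toLin u) := by
  rintro ⟨v, s, t, hne, hs, ht⟩
  obtain ⟨α, hα⟩ := D.exists_smul_center_of_toLin_cameras_eq hs
  obtain ⟨β, hβ⟩ := D.exists_smul_center_of_toLin_cameras_eq ht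
  have hst : s = t := by
    have hls := congrArg (complexForm T.l) hα
    have hlt := congrArg (complexForm T.l) hβ
    simp only [map_sub, map_add, map_smul, D.chart.complexForm_complexMap_self, mul_zero,
      add_zero, smul_eq_mul, sub_eq_zero] at hls hlt
    exact mul_right_cancel₀ hl (hls.symm.trans hlt)
  subst hst
  have hdiff : complexForm T.m v • (D.tangent i - D.tangent j) =
      α • D.center i - β • D.center j := by
    rw [← sub_eq_zero, ← D.chart.complexMap_eq_zero]
    simp only [map_sub, map_smul, ← hα, ← hβ]
    module
  have hmv : complexForm T.m v = 0 := eq_zero_of_smul_tangent_sub_eq D.form_isSymm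
    (D.center_cross_tangent i) (D.center_cross_tangent j)
    (D.center_dotProduct_center_ne_zero hP hij) hdiff
  have hα0 : α = 0 := by
    rw [hmv, zero_smul, eq_comm, sub_eq_zero] at hdiff
    have hcross := congrArg (D.center j ⨯₃ ·) hdiff
    simp only [map_smul, cross_self, smul_zero, smul_eq_zero] at hcross
    exact hcross.resolve_right (D.center_cross_center_ne_zero hP hij.symm)
  rw [hmv, hα0, zero_smul, zero_smul, add_zero, sub_eq_zero] at hα
  rw [hα, map_smul, smul_eq_mul] at hmv
  have hs0 := (mul_eq_zero.1 hmv).resolve_right hm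
  exact hne ⟨by rw [hα, hs0, zero_smul], hs0, hs0⟩

theorem exists_raysMeet_not_raysMeet_cameras (hP : Function.Injective (centers P)) {i j : Fin n}
    (hij : i ≠ j) :
    ∃ x y, RaysMeet (P i) (P j) x y ∧ ¬ RaysMeet (D.cameras i) (D.cameras j) x y := by
  obtain ⟨r, hl, hm⟩ := exists_dotProduct_ne_zero_and T.l_ne T.m_ne
  refine ⟨_, _, ⟨complexify r, 1, 1, by simp, (one_smul ℂ _).symm, (one_smul ℂ _).symm⟩,
    D.not_raysMeet_cameras hP hij ?_ ?_⟩ <;>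
  · rw [complexForm_complexify]
    exact_mod_cast ‹_›

end Rays

end TangentTwist

end Twisting

section Converse

open Matrix

variable {n : ℕ}

theorem planeLocus_smul {c : ℂ} (hc : c ≠ 0) (l : Fin 4 → ℂ) :
    planeLocus (c • l) = planeLocus l := by
  ext x
  refine forall₂_congr fun u _ => ?_
  rw [smul_dotProduct, smul_eq_mul, mul_eq_zero, or_iff_right hc]

/-- Rescaling the equation of the plane of `T` changes none of the loci given by `T`. -/
def PlaneConic.scalePlane (T : PlaneConic) (ε : ℝ) (hε : ε ≠ 0) : PlaneConic :=
  { T with m := ε • T.m, m_ne := smul_ne_zero hε T.m_ne }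

theorem PlaneConic.carrier_scalePlane (T : PlaneConic) {ε : ℝ} (hε : ε ≠ 0) :
    (T.scalePlane ε hε).carrier = T.carrier := by
  have h : (T.scalePlane ε hε).plane = T.plane := by
    have hc := complexify_smul ε T.m
    exact (congrArg planeLocus hc).trans (planeLocus_smul (Complex.ofReal_ne_zero.2 hε) _)
  exact congrArg (· ∪ T.conic) h

theorem PlaneConic.isProper_scalePlane_iff (T : PlaneConic) {ε : ℝ} (hε : ε ≠ 0) :
    (T.scalePlane ε hε).IsProper ↔ T.IsProper := by
  have h := LinearIndependent.pair_add_smul_add_smul_iff (R := ℝ) (x := T.m) (y := T.l)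
    (a := ε) (b := 0) (c := 0) (d := (1 : ℝ))
  simpa [PlaneConic.IsProper, PlaneConic.scalePlane, hε] using h

theorem PlaneChart.exists_center_of_mem_conic {T : PlaneConic} (χ : PlaneChart T.l) {P : Camera}
    (hP : P.center ∈ T.conic) :
    ∃ c : Fin 3 → ℝ, c ≠ 0 ∧ P.mat *ᵥ (χ.E *ᵥ c) = 0 ∧ c ⬝ᵥ (χ.restrict T.K *ᵥ c) = 0 := by
  obtain ⟨k, hk, hPk⟩ := P.exists_real_center
  rw [P.center_eq_mk_complexify hk hPk, T.mk_mem_conic, map_mulVec_complexify,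
    ← complexForm_apply, complexForm_complexify, complexForm_complexify] at hP
  have hl : T.l ⬝ᵥ k = 0 := by exact_mod_cast hP.1
  have hK : k ⬝ᵥ (T.K *ᵥ k) = 0 := by exact_mod_cast hP.2
  have hE := χ.E_mulVec_L_mulVec hl
  refine ⟨χ.L *ᵥ k, fun h => hk ?_, by rw [hE, hPk], by rw [χ.dotProduct_restrict_mulVec, hE, hK]⟩
  rw [← hE, h, mulVec_zero]

theorem exists_generic_scale (K : Matrix (Fin 3) (Fin 3) ℝ) (hK : K.det ≠ 0) (m : Fin 3 → ℝ)
    (w : Fin n → Fin 3 → ℝ) :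
    ∃ ε : ℝ, ε ≠ 0 ∧ (∀ i, 1 + (ε • m) ⬝ᵥ w i ≠ 0) ∧ (twistedForm K (ε • m)).det ≠ 0 := by
  have hw : ∀ i, ∀ᶠ ε : ℝ in nhds 0, 1 + (ε • m) ⬝ᵥ w i ≠ 0 := fun i => by
    simp only [smul_dotProduct]
    exact ContinuousAt.eventually_ne (by fun_prop) (by simp)
  have hform : ∀ᶠ ε : ℝ in nhds 0, (twistedForm K (ε • m)).det ≠ 0 := by
    refine ContinuousAt.eventually_ne (Continuous.continuousAt ?_) (by simpa [twistedForm])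
    unfold twistedForm
    fun_prop
  obtain ⟨ε, ⟨hεw, hεK⟩, hε⟩ := (((Filter.eventually_all.2 hw).and hform).filter_mono
    nhdsWithin_le_nhds |>.and (self_mem_nhdsWithin (s := {0}ᶜ))).exists
  exact ⟨ε, hε, hεw, hεK⟩

theorem TangentTwist.exists_scalePlane {P : Fin n → Camera} {T : PlaneConic} (hT : T.IsSmooth)
    (hP : ∀ i, centers P i ∈ T.conic) :
    ∃ ε, ∃ hε : ε ≠ 0, Nonempty (TangentTwist P (T.scalePlane ε hε)) := by
  obtain ⟨χ⟩ := PlaneChart.nonempty_of_ne_zero T.l_ne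
  choose c hc hPc hKc using fun i => χ.exists_center_of_mem_conic (hP i)
  choose w hw using fun i => exists_crossProduct_eq_mulVec_of_isotropic (hc i) (hKc i)
  have hdet := (T.isSmooth_iff_det_ne_zero χ).1 hT
  obtain ⟨ε, hε, hεw, hεK⟩ := exists_generic_scale _ hdet (T.m ᵥ* χ.E) w
  have hm : (T.scalePlane ε hε).m ᵥ* χ.E = ε • (T.m ᵥ* χ.E) := smul_vecMul ..
  exact ⟨ε, hε, ⟨χ, c, w, hc, hPc, hw, hdet, by rwa [hm], by rwa [hm]⟩⟩

theorem exists_conjugate_of_isSmooth (hn : 2 ≤ n) {P : Fin n → Camera}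
    (hP : Function.Injective (centers P)) {T : PlaneConic} (hT : T.IsSmooth)
    (hc : ∀ i, centers P i ∈ T.conic) :
    ∃ (Q : Fin n → Camera) (T' : PlaneConic), Function.Injective (centers Q) ∧ T'.IsSmooth ∧
      (T'.IsProper ↔ T.IsProper) ∧ (∀ i, centers Q i ∈ T'.conic) ∧
      IsConjugate P T.carrier Q T'.carrier ∧
      ∀ X ⊆ T.carrier, ∃ Y ⊆ T'.carrier, IsConjugate P X Q Y := by
  obtain ⟨ε, hε, ⟨D⟩⟩ := TangentTwist.exists_scalePlane hT hc
  have hmatch : ∀ x ∈ T.carrier, ∃ y ∈ D.dual.carrier, HaveCommonImages P D.cameras x y := by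
    rw [← T.carrier_scalePlane hε]
    exact fun x hx => D.exists_mem_dual_carrier hx
  have hmatch' : ∀ y ∈ D.dual.carrier, ∃ x ∈ T.carrier, HaveCommonImages P D.cameras x y := by
    rw [← T.carrier_scalePlane hε]
    exact fun y hy => D.exists_mem_carrier hy
  refine ⟨D.cameras, D.dual, D.centers_cameras_injective hP, D.dual_isSmooth,
    T.isProper_scalePlane_iff hε, D.centers_cameras_mem_conic, ?_, fun X hX => ?_⟩
  · exact isConjugate_of_not_raysMeet hn
      (fun i j hij => D.exists_raysMeet_not_raysMeet_cameras hP hij)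
      (exists_common_reconstruction hmatch hmatch')
  · obtain ⟨Y, hY, hS⟩ := exists_subset_common_reconstruction fun x hx => hmatch x (hX hx)
    exact ⟨Y, hY, isConjugate_of_not_raysMeet hn
      (fun i j hij => D.exists_raysMeet_not_raysMeet_cameras hP hij) hS⟩

end Converse

section LinearForms

open Submodule

variable {F V : Type*} [Field F] [AddCommGroup V] [Module F V]

theorem span_pair_eq_of_mem {x y z : V} (h : x ∈ span F {y, z}) (hx : x ∉ span F {z}) :
    span F {x, z} = span F {y, z} := by
  rw [← span_insert_eq_span h, ← span_insert_eq_span (mem_span_insert_exchange h hx),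
    Set.insert_comm]

theorem notMem_span_singleton_comm {x y : V} (hx : x ≠ 0) (h : y ∉ span F {x}) :
    x ∉ span F {y} := fun hxy => by
  rw [← insert_empty_eq] at h hxy
  exact h (mem_span_insert_exchange hxy (by simpa))

theorem mem_span_singleton_of_ker_le {f g : Module.Dual F V} (h : ∀ u, g u = 0 → f u = 0) :
    f ∈ span F {g} := by
  rw [← Set.range_const (ι := Unit)]
  exact mem_span_of_iInf_ker_le_ker fun u hu => h u (by simpa using hu)

theorem mem_span_pair_of_ker_le {f g h : Module.Dual F V}
    (H : ∀ u, g u = 0 → h u = 0 → f u = 0) : f ∈ span F {g, h} := by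
  rw [← Matrix.range_cons_cons_empty g h ![]]
  refine mem_span_of_iInf_ker_le_ker fun u hu => ?_
  rw [mem_iInf] at hu
  exact H u (hu 0) (hu 1)

theorem forall_eq_zero_or_of_mul_eq_zero (W : Submodule F V) {f g : Module.Dual F V}
    (h : ∀ u ∈ W, f u * g u = 0) : (∀ u ∈ W, f u = 0) ∨ ∀ u ∈ W, g u = 0 := by
  by_contra! hc
  obtain ⟨⟨u, hu, hfu⟩, v, hv, hgv⟩ := hc
  have hgu := (mul_eq_zero.1 (h u hu)).resolve_left hfu
  have hfv := (mul_eq_zero.1 (h v hv)).resolve_right hgv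
  have huv := h (u + v) (W.add_mem hu hv)
  rw [map_add, map_add, hgu, hfv, add_zero, zero_add] at huv
  exact mul_ne_zero hfu hgv huv

theorem mem_span_singleton_or_of_mul_eq_zero {f g h : Module.Dual F V}
    (H : ∀ u, h u = 0 → f u * g u = 0) : f ∈ span F {h} ∨ g ∈ span F {h} :=
  (forall_eq_zero_or_of_mul_eq_zero (LinearMap.ker h) H).imp mem_span_singleton_of_ker_le
    mem_span_singleton_of_ker_le

theorem exists_eq_one_of_notMem_span_singleton {a b : Module.Dual F V} (h : a ∉ span F {b}) :
    ∃ v, a v = 1 ∧ b v = 0 := by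
  by_contra! hc
  refine h (mem_span_singleton_of_ker_le fun u hu => by_contra fun hau => ?_)
  exact hc ((a u)⁻¹ • u) (by simp [hau]) (by simp [hu])

theorem exists_eq_mul_of_eq_zero_iff (q : QuadraticForm F V) {a b : Module.Dual F V}
    (hab : LinearIndependent F ![a, b]) (hq : ∀ u, q u = 0 ↔ a u = 0 ∨ b u = 0) :
    ∃ κ : F, κ ≠ 0 ∧ ∀ u, q u = κ * (a u * b u) := by
  have hnotMem : ∀ {c d : Module.Dual F V}, LinearIndependent F ![c, d] → c ∉ span F {d} :=
    fun h => by simpa using (linearIndependent_finCons.1 h).2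
  obtain ⟨v, hav, hbv⟩ := exists_eq_one_of_notMem_span_singleton (hnotMem hab)
  obtain ⟨w, hbw, haw⟩ := exists_eq_one_of_notMem_span_singleton
    (hnotMem (LinearIndependent.pair_symm_iff.1 hab))
  have hpolar : ∀ r, a r = 0 → QuadraticMap.polar q r w = 0 := fun r har => by
    rw [QuadraticMap.polar, (hq (r + w)).2 (by simp [har, haw]), (hq r).2 (Or.inl har),
      (hq w).2 (Or.inl haw), sub_zero, sub_zero]
  have heq : ∀ u, q u = QuadraticMap.polar q v w * (a u * b u) := fun u => by
    have hr := hpolar (u - b u • w - a u • v) (by simp [hav, haw])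
    have hu := QuadraticMap.map_add q (u - b u • w) (b u • w)
    rw [sub_add_cancel, (hq (u - b u • w)).2 (by simp [hbw]), (hq (b u • w)).2 (by simp [haw]),
      QuadraticMap.polar_smul_right, smul_eq_mul] at hu
    rw [QuadraticMap.polar_sub_left q (u - b u • w), QuadraticMap.polar_smul_left, smul_eq_mul,
      sub_eq_zero] at hr
    rw [hu, hr]
    ring
  refine ⟨_, fun h0 => ?_, heq⟩
  have hvw := heq (v + w)
  rw [h0, zero_mul, hq] at hvw
  simp [hav, haw, hbv, hbw] at hvw

section Trifocal

variable {a b f g h h' h'' : Module.Dual F V} {κ κ' : F}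

theorem span_pair_eq_of_mul_eq_of_mem (hκ : κ ≠ 0) (ha : a ∉ span F {h}) (hb : b ∉ span F {h})
    (H : ∀ u, h u = 0 → f u * g u = κ * (a u * b u)) (haf : a ∈ span F {f, h}) :
    span F {a, h} = span F {f, h} ∧ span F {b, h} = span F {g, h} := by
  refine ⟨span_pair_eq_of_mem haf ha, span_pair_eq_of_mem ?_ hb⟩
  obtain ⟨c, d, rfl⟩ := mem_span_pair.1 haf
  have hfactor : ∀ u, h u = 0 → f u * (g - (κ * c) • b) u = 0 := fun u hu => by
    have hu' := H u hu
    simp only [LinearMap.add_apply, LinearMap.smul_apply, hu, smul_eq_mul, mul_zero,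
      add_zero, LinearMap.sub_apply] at hu' ⊢
    linear_combination hu'
  rcases mem_span_singleton_or_of_mul_eq_zero hfactor with hf | hg
  · exact absurd (add_mem (smul_mem _ c hf) (smul_mem _ d (mem_span_singleton_self h))) ha
  · have hc : c ≠ 0 := by
      rintro rfl
      exact ha (mem_span_singleton.2 ⟨d, by rw [zero_smul, zero_add]⟩)
    rw [← smul_mem_iff _ (mul_ne_zero hκ hc)]
    obtain ⟨e, he⟩ := mem_span_singleton.1 hg
    exact mem_span_pair.2 ⟨1, -e, by rw [neg_smul, he]; module⟩

theorem span_pair_eq_of_mul_eq (hκ : κ ≠ 0) (ha : a ∉ span F {h}) (hb : b ∉ span F {h})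
    (H : ∀ u, h u = 0 → f u * g u = κ * (a u * b u)) :
    (span F {a, h} = span F {f, h} ∧ span F {b, h} = span F {g, h}) ∨
      (span F {b, h} = span F {f, h} ∧ span F {a, h} = span F {g, h}) := by
  have hvanish : ∀ u ∈ LinearMap.ker f ⊓ LinearMap.ker h, a u * b u = 0 := fun u hu =>
    (mul_eq_zero.1 ((H u hu.2).symm.trans (mul_eq_zero_of_left hu.1 _))).resolve_left hκ
  refine (forall_eq_zero_or_of_mul_eq_zero _ hvanish).imp (fun hzero => ?_) fun hzero => ?_
  · exact span_pair_eq_of_mul_eq_of_mem hκ ha hb H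
      (mem_span_pair_of_ker_le fun u hf hh => hzero u ⟨hf, hh⟩)
  · exact span_pair_eq_of_mul_eq_of_mem hκ hb ha (fun u hu => by rw [H u hu, mul_comm (a u)])
      (mem_span_pair_of_ker_le fun u hf hh => hzero u ⟨hf, hh⟩)

theorem mem_span_pair_iff_notMem (hli : LinearIndependent F ![f, g, h]) (hκ : κ ≠ 0) (hκ' : κ' ≠ 0)
    (ha : a ∉ span F {h}) (hb : b ∉ span F {h})
    (H : ∀ u, h u = 0 → h' u * g u = κ * (a u * b u))
    (H' : ∀ u, h u = 0 → h'' u * f u = κ' * (a u * b u)) :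
    a ∈ span F {h', h} ↔ a ∉ span F {h'', h} := by
  have hfg : span F {f, h} ≠ span F {g, h} := fun heq => by
    have hf := (linearIndependent_finCons.1 hli).2
    rw [Matrix.range_cons_cons_empty, ← heq] at hf
    exact hf (subset_span (Set.mem_insert f {h}))
  have hmem : a ∈ span F {a, h} := subset_span (Set.mem_insert a {h})
  have hmem_iff : ∀ x, a ∈ span F {x, h} ↔ span F {a, h} = span F {x, h} := fun x =>
    ⟨fun hx => span_pair_eq_of_mem hx ha, fun hx => hx ▸ hmem⟩
  rw [hmem_iff, hmem_iff]
  rcases span_pair_eq_of_mul_eq hκ ha hb H with ⟨h1, h2⟩ | ⟨h1, h2⟩ <;>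
    rcases span_pair_eq_of_mul_eq hκ' ha hb H' with ⟨h3, h4⟩ | ⟨h3, h4⟩ <;>
    grind

theorem mem_span_singleton_of_mul_sub_eq (hli : LinearIndependent F ![g, h])
    (H : ∀ u, g u * h' u - h u * f u = κ * (a u * b u)) (hh : h ∈ span F {a}) :
    h' ∈ span F {a} := by
  refine (mem_span_singleton_or_of_mul_eq_zero (f := g) fun u hu => ?_).resolve_left fun hg => ?_
  · obtain ⟨c, rfl⟩ := mem_span_singleton.1 hh
    simpa [hu] using H u
  · have ha : a ∈ span F {h} := by
      by_contra hah
      exact notMem_span_singleton_comm (hli.ne_zero 1) hah hh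
    have hgh := (linearIndependent_finCons.1 hli).2
    rw [Matrix.range_cons, Matrix.range_empty, Set.union_empty] at hgh
    exact hgh (span_le.2 (Set.singleton_subset_iff.2 ha) hg)

end Trifocal

/-- If some view had `h i` off both planes, then so would all, and each of the planes would belong
to one of the two pencils at `h i`, never to both: impossible around a cycle of odd length. -/
theorem forall_mem_span_singleton_of_cyclic {a b : Module.Dual F V}
    {f g h : Fin 3 → Module.Dual F V} {κ : Fin 3 → F} (ha : a ≠ 0) (hb : b ≠ 0)
    (hli : ∀ i, LinearIndependent F ![f i, g i, h i]) (hκ : ∀ i, κ i ≠ 0)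
    (H : ∀ i u, g i u * h (i + 1) u - h i u * f (i + 1) u = κ i * (a u * b u)) :
    (∀ i, h i ∈ span F {a}) ∨ ∀ i, h i ∈ span F {b} := by
  have hprop : ∀ c : Module.Dual F V, (∀ i, h i ∈ span F {c} → h (i + 1) ∈ span F {c}) →
      ∀ i, h i ∈ span F {c} → ∀ j, h j ∈ span F {c} := by
    intro c hstep i hi j
    obtain rfl | rfl | rfl : j = i ∨ j = i + 1 ∨ j = i + 1 + 1 := by lia
    exacts [hi, hstep _ hi, hstep _ (hstep _ hi)]
  by_contra! hne
  have hah : ∀ i, a ∉ span F {h i} := fun i => notMem_span_singleton_comm ha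
    fun hi => hne.1.elim fun j hj => hj (hprop a (fun k => mem_span_singleton_of_mul_sub_eq
      (linearIndependent_finCons.1 (hli k)).1 (H k)) i hi j)
  have hbh : ∀ i, b ∉ span F {h i} := fun i => notMem_span_singleton_comm hb
    fun hi => hne.2.elim fun j hj => hj (hprop b (fun k => mem_span_singleton_of_mul_sub_eq
      (linearIndependent_finCons.1 (hli k)).1 fun u => by rw [H k u, mul_comm (a u)]) i hi j)
  have halt : ∀ i, a ∈ span F {h (i + 1), h i} ↔ a ∉ span F {h i, h (i + 2)} := fun i => by
    rw [Set.pair_comm (h i)]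
    refine mem_span_pair_iff_notMem (hli i) (hκ i) (neg_ne_zero.2 (hκ (i + 2))) (hah i) (hbh i)
      (fun u hu => ?_) fun u hu => ?_
    · linear_combination H i u + f (i + 1) u * hu
    · have hi := H (i + 2) u
      rw [show i + 2 + 1 = i by lia] at hi
      linear_combination -hi + g (i + 2) u * hu
  have h0 : _ ↔ a ∉ span F {h 0, h 2} := halt 0
  have h1 : _ ↔ a ∉ span F {h 1, h 0} := halt 1
  have h2 : a ∈ span F {h 0, h 2} ↔ a ∉ span F {h 2, h 1} := halt 2
  tauto

end LinearForms

section UniversalCameras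

open Matrix

variable {F : Type*} [Field F]

/-- Three projections `ℙ⁴ ⇢ ℙ²` whose centers are pairwise skew lines in the space `ξ 4 = 0`. In the
situation of the theorem the cameras `P i` and `Q i` are both restrictions of `universalCamera i`,
to two different hyperplanes of `ℙ⁴`. -/
def universalCamera (i : Fin 3) : (Fin 5 → F) →ₗ[F] (Fin 3 → F) where
  toFun ξ := ![ξ (Fin.castAdd 2 (i + 1)), ξ (Fin.castAdd 2 (i + 2)) + ξ 3, ξ 4]
  map_add' ξ η := by simp [add_add_add_comm]
  map_smul' c ξ := by simp [mul_add]

/-- A form cutting out, in the space `ξ 4 = 0`, the quadric surface swept by the common transversals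
of the centers of the universal cameras. -/
def transversalMatrix (F : Type*) [Field F] : Matrix (Fin 5) (Fin 5) F :=
  !![0, 1, 1, 1, 0; 1, 0, 1, 1, 0; 1, 1, 0, 1, 0; 1, 1, 1, 2, 0; 0, 0, 0, 0, 0]

theorem universalCamera_apply (i : Fin 3) (ξ : Fin 5 → F) :
    universalCamera i ξ =
      ![ξ (Fin.castAdd 2 (i + 1)), ξ (Fin.castAdd 2 (i + 2)) + ξ 3, ξ 4] := rfl

theorem dotProduct_transversalMatrix_mulVec (ξ η : Fin 5 → F) :
    ξ ⬝ᵥ (transversalMatrix F *ᵥ η) =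
      ξ 0 * (η 1 + η 2 + η 3) + ξ 1 * (η 0 + η 2 + η 3) + ξ 2 * (η 0 + η 1 + η 3) +
        ξ 3 * (η 0 + η 1 + η 2 + 2 * η 3) := by
  simp [transversalMatrix, dotProduct, mulVec, Fin.sum_univ_succ]
  ring

theorem universalCamera_eq_zero_iff {i : Fin 3} {ξ : Fin 5 → F} :
    universalCamera i ξ = 0 ↔
      ξ (Fin.castAdd 2 (i + 1)) = 0 ∧ ξ (Fin.castAdd 2 (i + 2)) + ξ 3 = 0 ∧ ξ 4 = 0 := by
  simp [universalCamera_apply]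

theorem eq_zero_of_universalCamera_eq_zero {i : Fin 3} {ξ : Fin 5 → F}
    (h : universalCamera i ξ = 0) (h' : universalCamera (i + 1) ξ = 0) : ξ = 0 := by
  obtain ⟨h1, h2, h4⟩ := universalCamera_eq_zero_iff.1 h
  obtain ⟨h2', h0, -⟩ := universalCamera_eq_zero_iff.1 h'
  ext j
  fin_cases i <;> fin_cases j <;> simp_all

theorem transversalMatrix_isotropic_of_universalCamera_eq_zero {i : Fin 3} {ξ : Fin 5 → F}
    (h : universalCamera i ξ = 0) : ξ ⬝ᵥ (transversalMatrix F *ᵥ ξ) = 0 := by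
  obtain ⟨h1, h2, -⟩ := universalCamera_eq_zero_iff.1 h
  rw [dotProduct_transversalMatrix_mulVec]
  fin_cases i <;> grind

theorem not_linearIndependent_universalCamera_iff {i : Fin 3} {ξ η : Fin 5 → F} :
    ¬ LinearIndependent F ![universalCamera i ξ, universalCamera i η] ↔
      (ξ (Fin.castAdd 2 (i + 2)) + ξ 3) * η 4 = ξ 4 * (η (Fin.castAdd 2 (i + 2)) + η 3) ∧
      ξ 4 * η (Fin.castAdd 2 (i + 1)) = ξ (Fin.castAdd 2 (i + 1)) * η 4 ∧
      ξ (Fin.castAdd 2 (i + 1)) * (η (Fin.castAdd 2 (i + 2)) + η 3) =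
        (ξ (Fin.castAdd 2 (i + 2)) + ξ 3) * η (Fin.castAdd 2 (i + 1)) := by
  rw [← crossProduct_ne_zero_iff_linearIndependent, not_not, cross_apply]
  simp [universalCamera_apply, sub_eq_zero]

theorem exists_not_linearIndependent_universalCamera_of_apply_eq_zero [CharZero F]
    {ξ s : Fin 5 → F} (h : ξ 4 = 0) :
    (∃ η ≠ 0, η 4 = 0 ∧ s ⬝ᵥ η = 0 ∧
        ∀ i, ¬ LinearIndependent F ![universalCamera i ξ, universalCamera i η]) ↔
      s ⬝ᵥ ξ = 0 ∨ ξ ⬝ᵥ (transversalMatrix F *ᵥ ξ) = 0 := by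
  set N : Matrix (Fin 5) (Fin 5) F := !![0, 0, 0, 0, 1; s 0, s 1, s 2, s 3, s 4;
    0, -(ξ 2 + ξ 3), ξ 1, ξ 1, 0; ξ 2, 0, -(ξ 0 + ξ 3), ξ 2, 0; -(ξ 1 + ξ 3), ξ 0, 0, ξ 0, 0]
    with hN
  have hdet : 2 * N.det = s ⬝ᵥ ξ * (ξ ⬝ᵥ (transversalMatrix F *ᵥ ξ)) := by
    rw [dotProduct_transversalMatrix_mulVec]
    simp [hN, det_succ_row_zero, Fin.sum_univ_succ, dotProduct, h, Fin.succAbove]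
    ring
  rw [← mul_eq_zero, ← hdet, mul_eq_zero_iff_left two_ne_zero,
    ← exists_mulVec_eq_zero_iff]
  refine exists_congr fun η => and_congr_right fun _ => ?_
  simp only [not_linearIndependent_universalCamera_iff, Fin.forall_fin_succ, funext_iff]
  simp [hN, mulVec, dotProduct, Fin.sum_univ_succ, h]
  grind

theorem smul_eq_smul_of_not_linearIndependent_universalCamera {ξ η : Fin 5 → F}
    (h : ∀ i, ¬ LinearIndependent F ![universalCamera i ξ, universalCamera i η]) :
    η 4 • ξ = ξ 4 • η := by
  have h0 : ξ 4 * η 0 = ξ 0 * η 4 := (not_linearIndependent_universalCamera_iff.1 (h 2)).2.1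
  have h1 : ξ 4 * η 1 = ξ 1 * η 4 := (not_linearIndependent_universalCamera_iff.1 (h 0)).2.1
  have h2 : ξ 4 * η 2 = ξ 2 * η 4 := (not_linearIndependent_universalCamera_iff.1 (h 1)).2.1
  have h3 : (ξ 2 + ξ 3) * η 4 = ξ 4 * (η 2 + η 3) :=
    (not_linearIndependent_universalCamera_iff.1 (h 0)).1
  ext j
  rw [Pi.smul_apply, Pi.smul_apply, smul_eq_mul, smul_eq_mul]
  fin_cases j <;> grind

theorem exists_not_linearIndependent_universalCamera_iff [CharZero F] {ξ s : Fin 5 → F}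
    (hξ : ξ ≠ 0) :
    (∃ η ≠ 0, s ⬝ᵥ η = 0 ∧ ∀ i, ¬ LinearIndependent F ![universalCamera i ξ, universalCamera i η]) ↔
      s ⬝ᵥ ξ = 0 ∨ ξ 4 = 0 ∧ ξ ⬝ᵥ (transversalMatrix F *ᵥ ξ) = 0 := by
  constructor
  · rintro ⟨η, hη, hs, hdep⟩
    have hsmul := smul_eq_smul_of_not_linearIndependent_universalCamera hdep
    by_cases hη4 : η 4 = 0
    · have hξ4 : ξ 4 = 0 := by
        rw [hη4, zero_smul] at hsmul
        exact (smul_eq_zero.1 hsmul.symm).resolve_right hη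
      exact ((exists_not_linearIndependent_universalCamera_of_apply_eq_zero hξ4).1
        ⟨η, hη, hη4, hs, hdep⟩).imp_right fun hQ => ⟨hξ4, hQ⟩
    · left
      have hdot := congrArg (s ⬝ᵥ ·) hsmul
      simp only [dotProduct_smul, hs, smul_zero] at hdot
      exact (smul_eq_zero.1 hdot).resolve_left hη4
  · rintro (hs | ⟨hξ4, hQ⟩)
    · exact ⟨ξ, hξ, hs, fun i hi => hi.injective.ne (show (0 : Fin 2) ≠ 1 by decide) rfl⟩
    · obtain ⟨η, hη, -, h⟩ :=
        (exists_not_linearIndependent_universalCamera_of_apply_eq_zero hξ4).2 (Or.inr hQ)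
      exact ⟨η, hη, h⟩

theorem exists_universalCamera_eq_and_eq {i : Fin 3} {p q : Fin 3 → F} (h : p 2 = q 2) :
    ∃ ζ, universalCamera i ζ = p ∧ universalCamera (i + 1) ζ = q := by
  suffices ∃ ζ : Fin 5 → F, ζ (Fin.castAdd 2 (i + 1)) = p 0 ∧ ζ (Fin.castAdd 2 (i + 2)) = q 0 ∧
      ζ 3 = p 1 - q 0 ∧ ζ (Fin.castAdd 2 i) = q 1 - p 1 + q 0 ∧ ζ 4 = p 2 by
    obtain ⟨ζ, h1, h2, h3, h0, h4⟩ := this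
    refine ⟨ζ, ?_, ?_⟩ <;> ext j <;> fin_cases j <;>
      simp [universalCamera_apply, add_assoc, *]
  fin_cases i
  · exact ⟨![q 1 - p 1 + q 0, p 0, q 0, p 1 - q 0, p 2], rfl, rfl, rfl, rfl, rfl⟩
  · exact ⟨![q 0, q 1 - p 1 + q 0, p 0, p 1 - q 0, p 2], rfl, rfl, rfl, rfl, rfl⟩
  · exact ⟨![p 0, q 0, q 1 - p 1 + q 0, p 1 - q 0, p 2], rfl, rfl, rfl, rfl, rfl⟩

theorem exists_universalCamera_eq_smul_iff {i : Fin 3} {η r : Fin 5 → F} :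
    (∃ (ζ : Fin 5 → F) (s t : F), r ⬝ᵥ ζ = 0 ∧ ¬ (ζ = 0 ∧ s = 0 ∧ t = 0) ∧
        universalCamera i ζ = s • universalCamera i η ∧
        universalCamera (i + 1) ζ = t • universalCamera (i + 1) η) ↔
      r ⬝ᵥ η = 0 ∨ η 4 = 0 := by
  constructor
  · rintro ⟨ζ, s, t, hr, hne, hs, ht⟩
    by_contra! hη
    have hst : s = t := by
      have hs4 : ζ 4 = s * η 4 := congrFun hs 2
      have ht4 : ζ 4 = t * η 4 := congrFun ht 2
      exact mul_right_cancel₀ hη.2 (hs4.symm.trans ht4)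
    subst hst
    have hζ : ζ = s • η := sub_eq_zero.1 <| eq_zero_of_universalCamera_eq_zero (i := i)
      (by rw [map_sub, map_smul, hs, sub_self]) (by rw [map_sub, map_smul, ht, sub_self])
    rw [hζ, dotProduct_smul, smul_eq_mul] at hr
    have hs0 := (mul_eq_zero.1 hr).resolve_right hη.1
    exact hne ⟨by rw [hζ, hs0, zero_smul], hs0, hs0⟩
  · rintro (hr | h4)
    · exact ⟨η, 1, 1, hr, fun h => one_ne_zero h.2.1, (one_smul F _).symm, (one_smul F _).symm⟩
    · obtain ⟨α, hα, hα'⟩ := exists_universalCamera_eq_and_eq (i := i) (p := universalCamera i η)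
        (q := 0) h4
      obtain ⟨β, hβ, hβ'⟩ := exists_universalCamera_eq_and_eq (i := i) (p := 0)
        (q := universalCamera (i + 1) η) h4.symm
      by_cases hrα : r ⬝ᵥ α = 0
      · exact ⟨α, 1, 0, hrα, fun h => one_ne_zero h.2.1, by rw [hα, one_smul],
          by rw [hα', zero_smul]⟩
      · refine ⟨(r ⬝ᵥ β) • α - (r ⬝ᵥ α) • β, r ⬝ᵥ β, -(r ⬝ᵥ α), ?_,
          fun h => hrα (neg_eq_zero.1 h.2.2), ?_, ?_⟩
        · rw [dotProduct_sub, dotProduct_smul, dotProduct_smul, smul_eq_mul, smul_eq_mul, mul_comm,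
            sub_self]
        · rw [map_sub, map_smul, map_smul, hα, hβ, smul_zero, sub_zero]
        · rw [map_sub, map_smul, map_smul, hα', hβ', smul_zero, zero_sub, neg_smul]

theorem exists_dotProduct_eq_zero_and_anisotropic [CharZero F] (r : Fin 5 → F) :
    ∃ ξ : Fin 5 → F, r ⬝ᵥ ξ = 0 ∧ ξ 4 = 0 ∧ ξ ⬝ᵥ (transversalMatrix F *ᵥ ξ) ≠ 0 := by
  by_contra! h
  have hQ : ∀ a b c d : F, r 0 * a + r 1 * b + r 2 * c + r 3 * d = 0 →
      a * b + b * c + c * a + d * (a + b + c + d) = 0 := fun a b c d hr => by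
    have hzero := h ![a, b, c, d, 0] (by simpa [dotProduct, Fin.sum_univ_five] using hr) rfl
    rw [dotProduct_transversalMatrix_mulVec] at hzero
    refine (mul_eq_zero.1 (Eq.trans ?_ hzero)).resolve_left two_ne_zero
    simp only [cons_val]
    ring
  have h01 : r 0 * r 1 = 0 := by linear_combination -hQ (r 1) (-r 0) 0 0 (by ring)
  have h12 : r 1 * r 2 = 0 := by linear_combination -hQ 0 (r 2) (-r 1) 0 (by ring)
  have h02 : r 0 * r 2 = 0 := by linear_combination -hQ (r 2) 0 (-r 0) 0 (by ring)
  have h03 : r 0 * (r 3 - r 0) = 0 := by linear_combination -hQ (r 3) 0 0 (-r 0) (by ring)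
  have h13 : r 1 * (r 3 - r 1) = 0 := by linear_combination -hQ 0 (r 3) 0 (-r 1) (by ring)
  have hne01 : r 0 + r 1 ≠ 0 := fun h0 =>
    one_ne_zero (by linear_combination hQ 1 1 0 0 (by linear_combination h0))
  have hne12 : r 1 + r 2 ≠ 0 := fun h0 =>
    one_ne_zero (by linear_combination hQ 0 1 1 0 (by linear_combination h0))
  have hne02 : r 0 + r 2 ≠ 0 := fun h0 =>
    one_ne_zero (by linear_combination hQ 1 0 1 0 (by linear_combination h0))
  grind

theorem exists_universalCamera_smul_add_smul_eq_zero {i : Fin 3} {ξ η : Fin 5 → F}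
    (hξ : universalCamera i ξ = 0) (hη : universalCamera (i + 1) η = 0)
    (h : ξ ⬝ᵥ (transversalMatrix F *ᵥ η) = 0) :
    ∃ s t : F, ¬ (s = 0 ∧ t = 0) ∧ universalCamera (i + 2) (s • ξ + t • η) = 0 := by
  rw [universalCamera_eq_zero_iff] at hξ hη
  rw [dotProduct_transversalMatrix_mulVec] at h
  obtain ⟨v, hv, hker⟩ := exists_mulVec_eq_zero_iff.2
    (show !![ξ (Fin.castAdd 2 i), η (Fin.castAdd 2 i); ξ (Fin.castAdd 2 (i + 1)) + ξ 3,
      η (Fin.castAdd 2 (i + 1)) + η 3].det = 0 by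
      rw [det_fin_two_of]
      fin_cases i <;> grind)
  have h0 : ξ (Fin.castAdd 2 i) * v 0 + η (Fin.castAdd 2 i) * v 1 = 0 := by
    simpa [vecHead, vecTail] using congrFun hker 0
  have h1 : (ξ (Fin.castAdd 2 (i + 1)) + ξ 3) * v 0 + (η (Fin.castAdd 2 (i + 1)) + η 3) * v 1 = 0 :=
    by simpa [vecHead, vecTail] using congrFun hker 1
  refine ⟨v 0, v 1, fun h0 => hv (by ext j; fin_cases j <;> simp [h0]), ?_⟩
  rw [universalCamera_eq_zero_iff, show i + 2 + 1 = i by lia, show i + 2 + 2 = i + 1 by lia]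
  simp only [Pi.add_apply, Pi.smul_apply, smul_eq_mul, hξ.2.2, hη.2.2, mul_zero, add_zero,
    and_true]
  exact ⟨by linear_combination h0, by linear_combination h1⟩

end UniversalCameras

section AdaptedMaps

variable {P Q P' Q' : Camera} {p q p' q' : (Fin 4 → ℂ) →ₗ[ℂ] (Fin 3 → ℂ)}

/-- Up to scalars and a common change of image coordinates, the cameras `P` and `Q` are the linear
maps `p` and `q`. The pairs of equal image points only depend on `p` and `q`. -/
def Adapted (P Q : Camera) (p q : (Fin 4 → ℂ) →ₗ[ℂ] (Fin 3 → ℂ)) : Prop :=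
  ∃ (e : (Fin 3 → ℂ) ≃ₗ[ℂ] (Fin 3 → ℂ)) (c : ℂ), c ≠ 0 ∧ (∀ u, P.toLin u = e (p u)) ∧
    ∀ v, Q.toLin v = c • e (q v)

namespace Adapted

theorem of_comp (h : Adapted P Q p q) (e : (Fin 3 → ℂ) ≃ₗ[ℂ] (Fin 3 → ℂ)) {c : ℂ} (hc : c ≠ 0)
    (hp : ∀ u, p u = e (p' u)) (hq : ∀ v, q v = c • e (q' v)) : Adapted P Q p' q' := by
  obtain ⟨e₀, c₀, hc₀, hP, hQ⟩ := h
  refine ⟨e.trans e₀, c₀ * c, mul_ne_zero hc₀ hc, fun u => ?_, fun v => ?_⟩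
  · rw [hP, hp, LinearEquiv.trans_apply]
  · rw [hQ, hq, map_smul, smul_smul, LinearEquiv.trans_apply]

theorem symm (h : Adapted P Q p q) : Adapted Q P q p := by
  obtain ⟨e, c, hc, hP, hQ⟩ := h
  refine ⟨e.trans (LinearEquiv.smulOfNeZero ℂ _ c hc), c⁻¹, inv_ne_zero hc, hQ, fun u => ?_⟩
  rw [hP, LinearEquiv.trans_apply, LinearEquiv.smulOfNeZero_apply, inv_smul_smul₀ hc]

theorem toLin_eq_zero_iff (h : Adapted P Q p q) {u : Fin 4 → ℂ} : P.toLin u = 0 ↔ p u = 0 := by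
  obtain ⟨e, c, -, hP, -⟩ := h
  rw [hP, LinearEquiv.map_eq_zero_iff]

theorem surjective (h : Adapted P Q p q) : Function.Surjective p := by
  obtain ⟨e, c, -, hP, -⟩ := h
  refine fun y => (P.toLin_surjective (e y)).imp fun u hu => e.injective ?_
  rw [← hP, hu]

theorem linearIndependent_pair_iff (h : Adapted P Q p q) {u v : Fin 4 → ℂ} :
    LinearIndependent ℂ ![P.toLin u, Q.toLin v] ↔ LinearIndependent ℂ ![p u, q v] := by
  obtain ⟨e, c, hc, hP, hQ⟩ := h
  rw [hP, hQ, ← one_smul ℂ (e (p u)), LinearIndependent.pair_smul_smul_iff isUnit_one hc.isUnit,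
    ← LinearMap.linearIndependent_iff (v := ![p u, q v]) e.toLinearMap e.ker,
    LinearEquiv.coe_coe, ← FinVec.map_eq]
  rfl

theorem raysMeet_iff (h : Adapted P Q p q) (h' : Adapted P' Q' p' q') {u : Fin 4 → ℂ} :
    RaysMeet Q Q' (P.toLin u) (P'.toLin u) ↔ ∃ (w : Fin 4 → ℂ) (s t : ℂ),
      ¬ (w = 0 ∧ s = 0 ∧ t = 0) ∧ q w = s • p u ∧ q' w = t • p' u := by
  obtain ⟨e, c, hc, hP, hQ⟩ := h
  obtain ⟨e', c', hc', hP', hQ'⟩ := h'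
  have hiff : ∀ w s t, Q.toLin w = (c * s) • P.toLin u ∧ Q'.toLin w = (c' * t) • P'.toLin u ↔
      q w = s • p u ∧ q' w = t • p' u := fun w s t => by
    rw [hQ, hP, hQ', hP', mul_smul, mul_smul, smul_right_inj hc, smul_right_inj hc', ← map_smul e,
      ← map_smul e', e.injective.eq_iff, e'.injective.eq_iff]
  constructor
  · rintro ⟨w, s, t, hne, hst⟩
    refine ⟨w, c⁻¹ * s, c'⁻¹ * t, by simpa [hc, hc'] using hne, (hiff _ _ _).1 ?_⟩
    rwa [mul_inv_cancel_left₀ hc, mul_inv_cancel_left₀ hc']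
  · rintro ⟨w, s, t, hne, hst⟩
    exact ⟨w, c * s, c' * t, by simpa [hc, hc'] using hne, (hiff _ _ _).2 hst⟩

end Adapted

end AdaptedMaps

section Hyperplanes

/-- The matrix `X` identifies `ℙ³` with the hyperplane `r = 0` of `ℙ⁴`. -/
structure Parametrizes (X : Matrix (Fin 5) (Fin 4) ℝ) (r : Fin 5 → ℝ) : Prop where
  injective : Function.Injective (X.map (algebraMap ℝ ℂ)).mulVecLin
  exists_mulVec_eq_iff : ∀ {ξ : Fin 5 → ℂ},
    (∃ u, X.map (algebraMap ℝ ℂ) *ᵥ u = ξ) ↔ complexForm r ξ = 0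

theorem complexForm_vecMul {k m : ℕ} (A : Matrix (Fin m) (Fin k) ℝ) (r : Fin m → ℝ)
    (u : Fin k → ℂ) :
    complexForm (r ᵥ* A) u = complexForm r (A.map (algebraMap ℝ ℂ) *ᵥ u) := by
  rw [complexForm_apply, complexForm_apply, Matrix.dotProduct_mulVec]
  congr 1
  exact funext (RingHom.map_vecMul (algebraMap ℝ ℂ) A r)

theorem dotProduct_transpose_mul_mul_mulVec {R : Type*} [CommSemiring R] {k m : ℕ}
    (A : Matrix (Fin m) (Fin k) R) (K : Matrix (Fin m) (Fin m) R) (u v : Fin k → R) :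
    u ⬝ᵥ ((Aᵀ * K * A) *ᵥ v) = (A *ᵥ u) ⬝ᵥ (K *ᵥ (A *ᵥ v)) := by
  rw [← Matrix.mulVec_mulVec, ← Matrix.mulVec_mulVec, Matrix.dotProduct_mulVec u,
    Matrix.vecMul_transpose]

theorem mem_span_of_complexForm_mem_span {k : ℕ} {r s : Fin k → ℝ}
    (h : complexForm r ∈ Submodule.span ℂ {complexForm s}) : r ∈ Submodule.span ℝ {s} := by
  obtain ⟨z, hz⟩ := Submodule.mem_span_singleton.1 h
  refine Submodule.mem_span_singleton.2 ⟨z.re, funext fun j => ?_⟩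
  have hj := congrArg Complex.re (LinearMap.congr_fun hz (Pi.single j 1))
  simpa [complexForm_apply, complexify_apply] using hj

namespace Parametrizes

variable {X : Matrix (Fin 5) (Fin 4) ℝ} {r : Fin 5 → ℝ}

theorem of_vecMul_eq_zero (hX : Function.Injective (X.map (algebraMap ℝ ℂ)).mulVecLin) (hr : r ≠ 0)
    (hrX : r ᵥ* X = 0) : Parametrizes X r := by
  refine ⟨hX, fun {ξ} => ?_⟩
  suffices LinearMap.range (X.map (algebraMap ℝ ℂ)).mulVecLin = LinearMap.ker (complexForm r) from
    SetLike.ext_iff.1 this ξ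
  refine Submodule.eq_of_le_of_finrank_eq ?_ ?_
  · rintro _ ⟨u, rfl⟩
    rw [LinearMap.mem_ker, Matrix.mulVecLin_apply, ← complexForm_vecMul, hrX, map_zero,
      LinearMap.zero_apply]
  · have hker := Module.Dual.finrank_ker_add_one_of_ne_zero
      ((map_ne_zero_iff _ complexForm_injective).2 hr)
    rw [Module.finrank_fin_fun] at hker
    rw [LinearMap.finrank_range_of_inj hX, Module.finrank_fin_fun]
    omega

theorem exists_real_mulVec_eq (h : Parametrizes X r) {ξ : Fin 5 → ℝ} (hξ : r ⬝ᵥ ξ = 0) :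
    ∃ x, X *ᵥ x = ξ := by
  obtain ⟨u, hu⟩ := h.exists_mulVec_eq_iff.2
    (show complexForm r (complexify ξ) = 0 by rw [complexForm_complexify, hξ, Complex.ofReal_zero])
  refine ⟨fun j => (u j).re, funext fun j => ?_⟩
  have hj := congrArg Complex.re (congrFun hu j)
  simpa [map_mulVec_apply, complexForm_apply, complexify_apply, dotProduct, Matrix.mulVec] using hj

theorem mem_span_of_vecMul_eq_zero (h : Parametrizes X r) {s : Fin 5 → ℝ} (hs : s ᵥ* X = 0) :
    s ∈ Submodule.span ℝ {r} := by
  refine mem_span_of_complexForm_mem_span (mem_span_singleton_of_ker_le fun ξ hξ => ?_)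
  obtain ⟨u, rfl⟩ := h.exists_mulVec_eq_iff.2 hξ
  rw [← complexForm_vecMul, hs, map_zero, LinearMap.zero_apply]

theorem linearIndependent_vecMul (h : Parametrizes X r) {s t : Fin 5 → ℝ}
    (hli : LinearIndependent ℝ ![r, s, t]) : LinearIndependent ℝ ![s ᵥ* X, t ᵥ* X] := by
  refine LinearIndependent.pair_iff.2 fun c d hcd => ?_
  rw [← Matrix.smul_vecMul, ← Matrix.smul_vecMul, ← Matrix.add_vecMul] at hcd
  obtain ⟨e, he⟩ := Submodule.mem_span_singleton.1 (h.mem_span_of_vecMul_eq_zero hcd)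
  have hzero := Fintype.linearIndependent_iff.1 hli ![-e, c, d] (by
    simp only [Fin.sum_univ_three, Matrix.cons_val, neg_smul, he]
    module)
  exact ⟨hzero 1, hzero 2⟩

end Parametrizes

end Hyperplanes

section CommonLifts

theorem transversalMatrix_map :
    (transversalMatrix ℝ).map (algebraMap ℝ ℂ) = transversalMatrix ℂ := by
  ext i j
  fin_cases i <;> fin_cases j <;> simp [transversalMatrix]

theorem transversalMatrix_isSymm {F : Type*} [Field F] : (transversalMatrix F).IsSymm := by
  ext i j
  fin_cases i <;> fin_cases j <;> rfl

theorem universalCamera_complexify (i : Fin 3) (ξ : Fin 5 → ℝ) :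
    universalCamera i (complexify ξ) = complexify (universalCamera i ξ) := by
  ext j
  fin_cases j <;> simp [universalCamera_apply, complexify_apply]

/-- Up to the choice of coordinates, the cameras `P i` and `Q i` are the restrictions of one and the
same `universalCamera i` to the hyperplanes `r = 0` and `s = 0` of `ℙ⁴`. Neither hyperplane contains
the intersection of the other one with the hyperplane `ξ 4 = 0`. -/
structure CommonLift (P Q : Fin 3 → Camera) where
  X : Matrix (Fin 5) (Fin 4) ℝ
  Y : Matrix (Fin 5) (Fin 4) ℝ
  r : Fin 5 → ℝ
  s : Fin 5 → ℝ
  parametrizes_X : Parametrizes X r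
  parametrizes_Y : Parametrizes Y s
  linearIndependent : LinearIndependent ℝ ![r, s, Pi.single 4 1]
  adapted : ∀ i, Adapted (P i) (Q i) (universalCamera i ∘ₗ (X.map (algebraMap ℝ ℂ)).mulVecLin)
    (universalCamera i ∘ₗ (Y.map (algebraMap ℝ ℂ)).mulVecLin)

namespace CommonLift

variable {P Q : Fin 3 → Camera}

/-- The common lift with the two hyperplanes exchanged. -/
def symm (L : CommonLift P Q) : CommonLift Q P where
  X := L.Y
  Y := L.X
  r := L.s
  s := L.r
  parametrizes_X := L.parametrizes_Y
  parametrizes_Y := L.parametrizes_X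
  linearIndependent := by
    have hli := L.linearIndependent
    rw [← linearIndependent_equiv (Equiv.swap (0 : Fin 3) 1)]
    convert hli using 1
    ext j : 1
    fin_cases j <;> rfl
  adapted i := (L.adapted i).symm

variable (L : CommonLift P Q)

theorem linearIndependent_forms : LinearIndependent ℝ ![L.s ᵥ* L.X, L.X 4] := by
  have hli := L.parametrizes_X.linearIndependent_vecMul L.linearIndependent
  rwa [Matrix.single_one_vecMul] at hli

theorem exists_anisotropic :
    ∃ x, L.X 4 ⬝ᵥ x = 0 ∧ x ⬝ᵥ ((L.Xᵀ * transversalMatrix ℝ * L.X) *ᵥ x) ≠ 0 := by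
  obtain ⟨ξ, hr, h4, haniso⟩ := exists_dotProduct_eq_zero_and_anisotropic L.r
  obtain ⟨x, rfl⟩ := L.parametrizes_X.exists_real_mulVec_eq hr
  exact ⟨x, h4, by rwa [dotProduct_transpose_mul_mul_mulVec]⟩

/-- The critical points on the `P` side, for cameras with a common lift: the plane is cut out by the
hyperplane of the `Q` side, the conic by the common transversals of the universal cameras. -/
noncomputable def planeConic : PlaneConic where
  m := L.s ᵥ* L.X
  l := L.X 4
  K := L.Xᵀ * transversalMatrix ℝ * L.X
  m_ne := L.linearIndependent_forms.ne_zero 0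
  l_ne := L.linearIndependent_forms.ne_zero 1
  K_symm := by
    rw [Matrix.IsSymm, Matrix.transpose_mul, Matrix.transpose_mul, Matrix.transpose_transpose,
      transversalMatrix_isSymm, Matrix.mul_assoc]
  K_ne := L.exists_anisotropic

theorem isProper_planeConic : L.planeConic.IsProper := L.linearIndependent_forms

theorem mk_mem_plane_iff {u : Fin 4 → ℂ} (hu : u ≠ 0) :
    Projectivization.mk ℂ u hu ∈ L.planeConic.plane ↔
      complexForm L.s (L.X.map (algebraMap ℝ ℂ) *ᵥ u) = 0 := by
  rw [PlaneConic.mk_mem_plane, ← complexForm_vecMul]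
  rfl

theorem mk_mem_conicPlane_iff {u : Fin 4 → ℂ} (hu : u ≠ 0) :
    Projectivization.mk ℂ u hu ∈ L.planeConic.conicPlane ↔
      (L.X.map (algebraMap ℝ ℂ) *ᵥ u) 4 = 0 :=
  L.planeConic.mk_mem_conicPlane hu

theorem mk_mem_conic_iff {u : Fin 4 → ℂ} (hu : u ≠ 0) :
    Projectivization.mk ℂ u hu ∈ L.planeConic.conic ↔
      (L.X.map (algebraMap ℝ ℂ) *ᵥ u) 4 = 0 ∧
        (L.X.map (algebraMap ℝ ℂ) *ᵥ u) ⬝ᵥ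
          (transversalMatrix ℂ *ᵥ (L.X.map (algebraMap ℝ ℂ) *ᵥ u)) = 0 := by
  rw [PlaneConic.mk_mem_conic, ← transversalMatrix_map, ← dotProduct_transpose_mul_mul_mulVec,
    ← Matrix.transpose_map, ← Matrix.map_mul, ← Matrix.map_mul]
  rfl

theorem viewQuadric_eq {i j : Fin 3} (hij : i ≠ j) :
    viewQuadric P Q i j = L.planeConic.plane ∪ L.planeConic.conicPlane := by
  suffices ∀ i, viewQuadric P Q i (i + 1) = L.planeConic.plane ∪ L.planeConic.conicPlane by
    obtain rfl | rfl : j = i + 1 ∨ i = j + 1 := by lia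
    exacts [this i, (viewQuadric_comm P Q _ _).trans (this j)]
  intro i
  ext x
  induction x using Projectivization.ind with
  | h u hu =>
    rw [mk_mem_viewQuadric, (L.adapted i).raysMeet_iff (L.adapted (i + 1)), Set.mem_union,
      mk_mem_plane_iff, mk_mem_conicPlane_iff, complexForm_apply,
      ← exists_universalCamera_eq_smul_iff (i := i)]
    constructor
    · rintro ⟨w, a, b, hne, h⟩
      refine ⟨_, a, b, L.parametrizes_Y.exists_mulVec_eq_iff.1 ⟨w, rfl⟩, ?_, h⟩
      rwa [← Matrix.mulVecLin_apply, map_eq_zero_iff _ L.parametrizes_Y.injective]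
    · rintro ⟨ζ, a, b, hζ, hne, h⟩
      obtain ⟨w, rfl⟩ := L.parametrizes_Y.exists_mulVec_eq_iff.2 hζ
      refine ⟨w, a, b, ?_, h⟩
      rwa [← map_eq_zero_iff _ L.parametrizes_Y.injective, Matrix.mulVecLin_apply]

theorem criticalPoints_eq : criticalPoints P Q = L.planeConic.carrier := by
  ext x
  induction x using Projectivization.ind with
  | h u hu =>
    have hX : L.X.map (algebraMap ℝ ℂ) *ᵥ u ≠ 0 := by
      rwa [← Matrix.mulVecLin_apply, Ne, map_eq_zero_iff _ L.parametrizes_X.injective]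
    rw [mk_mem_criticalPoints, PlaneConic.carrier, Set.mem_union, mk_mem_plane_iff,
      mk_mem_conic_iff, complexForm_apply, ← exists_not_linearIndependent_universalCamera_iff hX]
    simp only [(L.adapted _).linearIndependent_pair_iff]
    constructor
    · rintro ⟨v, hv, h⟩
      refine ⟨_, ?_, L.parametrizes_Y.exists_mulVec_eq_iff.1 ⟨v, rfl⟩, h⟩
      rwa [← Matrix.mulVecLin_apply, Ne, map_eq_zero_iff _ L.parametrizes_Y.injective]
    · rintro ⟨η, hη, hs, h⟩
      obtain ⟨v, rfl⟩ := L.parametrizes_Y.exists_mulVec_eq_iff.2 hs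
      refine ⟨v, ?_, h⟩
      rintro rfl
      exact hη (Matrix.mulVec_zero _)

theorem mat_mulVec_eq_zero_iff (i : Fin 3) {x : Fin 4 → ℝ} :
    (P i).mat *ᵥ x = 0 ↔ universalCamera i (L.X *ᵥ x) = 0 := by
  rw [← complexify_eq_zero, ← Camera.toLin_complexify, (L.adapted i).toLin_eq_zero_iff,
    LinearMap.comp_apply, Matrix.mulVecLin_apply, map_mulVec_complexify, universalCamera_complexify,
    complexify_eq_zero]

theorem centers_mem_conic (i : Fin 3) : centers P i ∈ L.planeConic.conic := by
  obtain ⟨k, hk, hPk⟩ := (P i).exists_real_center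
  have hzero : universalCamera i (L.X.map (algebraMap ℝ ℂ) *ᵥ complexify k) = 0 := by
    rw [map_mulVec_complexify, universalCamera_complexify, (L.mat_mulVec_eq_zero_iff i).1 hPk,
      map_zero]
  rw [centers, (P i).center_eq_mk_complexify hk hPk, mk_mem_conic_iff]
  exact ⟨(universalCamera_eq_zero_iff.1 hzero).2.2,
    transversalMatrix_isotropic_of_universalCamera_eq_zero hzero⟩

end CommonLift

end CommonLifts

section Smoothness

theorem Camera.exists_eq_smul_of_mulVec_eq_zero (P : Camera) {k x : Fin 4 → ℝ} (hk : k ≠ 0)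
    (hPk : P.mat *ᵥ k = 0) (hPx : P.mat *ᵥ x = 0) : ∃ c : ℝ, x = c • k := by
  obtain ⟨z, hz⟩ := (P.toLin_eq_zero_iff (v := complexify x) (complexify_eq_zero.not.2 hk)
    (by rw [toLin_complexify, hPk, map_zero])).1 (by rw [toLin_complexify, hPx, map_zero])
  refine ⟨z.re, funext fun j => ?_⟩
  simpa [complexify_apply] using congrArg Complex.re (congrFun hz j)

theorem linearIndependent_of_independent_centers {ι : Type*} {P : ι → Camera} {k : ι → Fin 4 → ℝ}
    (h : Projectivization.Independent fun i => (P i).center) (hk : ∀ i, k i ≠ 0)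
    (hPk : ∀ i, (P i).mat *ᵥ k i = 0) : LinearIndependent ℝ k := by
  have hli : LinearIndependent ℂ (complexify ∘ k) := by
    rw [Projectivization.independent_iff_iSupIndep] at h
    refine (iSupIndep_iff_linearIndependent_of_ne_zero fun i =>
      complexify_eq_zero.not.2 (hk i)).1 ?_
    simpa only [Camera.center_eq_mk_complexify _ (hk _) (hPk _),
      Projectivization.submodule_mk] using h
  exact (hli.restrict_scalars' ℝ).of_comp complexify

section Bilinear

variable {F V : Type*} [Field F] [AddCommGroup V] [Module F V]

theorem mem_span_range_of_apply_eq_zero {ι : Type*} [Fintype ι] [FiniteDimensional F V]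
    {φ : Module.Dual F V} (hφ : φ ≠ 0) {c : ι → V} (hc : LinearIndependent F c)
    (hcard : Module.finrank F V = Fintype.card ι + 1) (hφc : ∀ i, φ (c i) = 0) {v : V}
    (hv : φ v = 0) : v ∈ Submodule.span F (Set.range c) := by
  have hle : Submodule.span F (Set.range c) ≤ LinearMap.ker φ :=
    Submodule.span_le.2 (Set.range_subset_iff.2 hφc)
  have hker := Module.Dual.finrank_ker_add_one_of_ne_zero hφ
  rw [Submodule.eq_of_le_of_finrank_eq hle (by rw [finrank_span_eq_card hc]; omega)]
  exact hv

theorem eq_zero_of_forall_isotropic_basis [NeZero (2 : F)] {B : LinearMap.BilinForm F V}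
    (hB : B.IsSymm) {c : Fin 3 → V} (hself : ∀ i, B (c i) (c i) = 0)
    (hne : ∀ i, B (c i) (c (i + 1)) ≠ 0) {v : V} (hv : v ∈ Submodule.span F (Set.range c))
    (horth : ∀ i, B (c i) v = 0) : v = 0 := by
  obtain ⟨t, rfl⟩ := (Submodule.mem_span_range_iff_exists_fun F).1 hv
  have h2 : (2 : F) ≠ 0 := NeZero.ne 2
  have h01 := hne 0
  have h12 := hne 1
  have h20 := hne 2
  have horth0 := horth 0
  have horth1 := horth 1
  have horth2 := horth 2
  simp only [zero_add, show (2 : Fin 3) + 1 = 0 from rfl, Fin.sum_univ_three,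
    map_add, map_smul, smul_eq_mul, hself, hB.eq (c 1) (c 0), hB.eq (c 2) (c 1),
    hB.eq (c 0) (c 2)] at h01 h12 h20 horth0 horth1 horth2
  have ht : t 0 = 0 ∧ t 1 = 0 ∧ t 2 = 0 := by
    grind
  simp [Fin.sum_univ_three, ht]

end Bilinear

namespace CommonLift

variable {P Q : Fin 3 → Camera} (L : CommonLift P Q)

theorem dotProduct_transversalMatrix_ne_zero {k : Fin 3 → Fin 4 → ℝ}
    (hPk : ∀ i, (P i).mat *ᵥ k i = 0) (hk : LinearIndependent ℝ k) (i : Fin 3) :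
    (L.X *ᵥ k i) ⬝ᵥ (transversalMatrix ℝ *ᵥ (L.X *ᵥ k (i + 1))) ≠ 0 := by
  intro hzero
  obtain ⟨a, b, hab, h⟩ := exists_universalCamera_smul_add_smul_eq_zero
    ((L.mat_mulVec_eq_zero_iff i).1 (hPk i)) ((L.mat_mulVec_eq_zero_iff (i + 1)).1 (hPk (i + 1)))
    hzero
  rw [← Matrix.mulVec_smul, ← Matrix.mulVec_smul, ← Matrix.mulVec_add,
    ← mat_mulVec_eq_zero_iff] at h
  obtain ⟨c, hc⟩ :=
    (P (i + 2)).exists_eq_smul_of_mulVec_eq_zero (hk.ne_zero (i + 2)) (hPk (i + 2)) h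
  have hshift : LinearIndependent ℝ fun j => k (i + j) := hk.comp _ (add_right_injective i)
  have hcoeff := Fintype.linearIndependent_iff.1 hshift ![a, b, -c] (by
    simp only [Fin.sum_univ_three, Matrix.cons_val, add_zero, neg_smul, hc, add_neg_cancel])
  exact hab ⟨hcoeff 0, hcoeff 1⟩

theorem isSmooth_planeConic (h : Projectivization.Independent (centers P)) :
    L.planeConic.IsSmooth := by
  choose k hk hPk using fun i => (P i).exists_real_center
  have hli := linearIndependent_of_independent_centers h hk hPk
  have hcamera : ∀ i, universalCamera i (L.X *ᵥ k i) = 0 := fun i =>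
    (L.mat_mulVec_eq_zero_iff i).1 (hPk i)
  have hplane : ∀ i, L.planeConic.l ⬝ᵥ k i = 0 := fun i =>
    (universalCamera_eq_zero_iff.1 (hcamera i)).2.2
  intro v hv horth
  refine eq_zero_of_forall_isotropic_basis
    (Matrix.isSymm_toBilin'_iff_isSymm.2 L.planeConic.K_symm) (c := k) (fun i => ?_) (fun i => ?_)
    ?_ fun i => ?_
  · rw [Matrix.toBilin'_apply', planeConic, dotProduct_transpose_mul_mul_mulVec]
    exact transversalMatrix_isotropic_of_universalCamera_eq_zero (hcamera i)
  · rw [Matrix.toBilin'_apply', planeConic, dotProduct_transpose_mul_mul_mulVec]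
    exact L.dotProduct_transversalMatrix_ne_zero hPk hli i
  · exact mem_span_range_of_apply_eq_zero
      ((map_ne_zero_iff _ (dotProductEquiv ℝ (Fin 4)).injective).2 L.planeConic.l_ne) hli (by simp)
      hplane hv
  · rw [Matrix.toBilin'_apply']
    exact horth _ (hplane i)

end CommonLift

end Smoothness

section ViewedRays

variable {F : Type*} [Field F]

theorem exists_smul_eq_smul_iff {a b c d : F} :
    (∃ s t : F, ¬ (s = 0 ∧ t = 0) ∧ s * a = t * c ∧ s * b = t * d) ↔ a * d = b * c := by
  constructor
  · rintro ⟨s, t, hst, hac, hbd⟩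
    grind
  · intro h
    by_cases hbd : d = 0 ∧ b = 0
    · by_cases hac : c = 0 ∧ a = 0
      · exact ⟨1, 1, by simp, by simp [hac], by simp [hbd]⟩
      · exact ⟨c, a, hac, mul_comm _ _, by simp [hbd]⟩
    · exact ⟨d, b, hbd, by rw [mul_comm, h], mul_comm _ _⟩

theorem exists_universalCamera_eq_smul_of_apply_three_iff {i : Fin 3} {p q : Fin 3 → F} :
    (∃ (ζ : Fin 5 → F) (s t : F), ζ 3 = 0 ∧ ¬ (ζ = 0 ∧ s = 0 ∧ t = 0) ∧
        universalCamera i ζ = s • p ∧ universalCamera (i + 1) ζ = t • q) ↔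
      p 1 * q 2 = p 2 * q 0 := by
  have hmiddle : ∀ ζ : Fin 5 → F,
      universalCamera i ζ 1 = universalCamera (i + 1) ζ 0 + ζ 3 := fun ζ => by
    simp only [universalCamera_apply, Matrix.cons_val, add_assoc]
    rfl
  rw [← exists_smul_eq_smul_iff]
  constructor
  · rintro ⟨ζ, s, t, h3, hne, hs, ht⟩
    refine ⟨s, t, ?_, ?_, (congrFun hs 2).symm.trans (congrFun ht 2)⟩
    · rintro ⟨rfl, rfl⟩
      rw [zero_smul] at hs ht
      exact hne ⟨eq_zero_of_universalCamera_eq_zero hs ht, rfl, rfl⟩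
    · simpa only [hs, ht, h3, add_zero, Pi.smul_apply, smul_eq_mul] using hmiddle ζ
  · rintro ⟨s, t, hne, h1, h2⟩
    obtain ⟨ζ, hs, ht⟩ := exists_universalCamera_eq_and_eq (i := i) (p := s • p) (q := t • q) h2
    refine ⟨ζ, s, t, ?_, fun h => hne h.2, hs, ht⟩
    simpa only [hs, ht, Pi.smul_apply, smul_eq_mul, h1, left_eq_add] using hmiddle ζ

end ViewedRays

section NormalizedCameras

theorem exists_eq_mul_of_mulVec_eq_zero {F ι κ m : Type*} [Field F] [Finite ι] [Fintype κ]
    [Fintype m] {A : Matrix ι m F} {M : Matrix κ m F} (h : ∀ x, M *ᵥ x = 0 → A *ᵥ x = 0) :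
    ∃ G : Matrix ι κ F, A = G * M := by
  classical
  choose G hG using fun i => (Submodule.mem_span_range_iff_exists_fun F).1
    (mem_span_of_iInf_ker_le_ker (L := fun j => dotProductEquiv F m (M j))
      (K := dotProductEquiv F m (A i)) fun x hx => congrFun (h x (funext fun j =>
        (Submodule.mem_iInf _).1 hx j)) i)
  refine ⟨Matrix.of G, ?_⟩
  ext i j
  have hij := LinearMap.congr_fun (hG i) (Pi.single j 1)
  simpa [Matrix.mul_apply] using hij.symm

theorem exists_adapted (P Q : Camera) {M : Matrix (Fin 3) (Fin 4) ℝ}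
    (h : ∀ x, M *ᵥ x = 0 → Q.mat *ᵥ x = 0) :
    ∃ p : Matrix (Fin 3) (Fin 4) ℝ,
      Adapted P Q (p.map (algebraMap ℝ ℂ)).mulVecLin (M.map (algebraMap ℝ ℂ)).mulVecLin := by
  obtain ⟨G, hG⟩ := exists_eq_mul_of_mulVec_eq_zero h
  have hunit : IsUnit G := by
    have hrank := Matrix.rank_mul_le_left G M
    rw [← hG, Q.rank_eq] at hrank
    refine Matrix.mulVec_surjective_iff_isUnit.1 (LinearMap.range_eq_top (f := G.mulVecLin) |>.1
      (Submodule.eq_top_of_finrank_eq ?_))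
    rw [Module.finrank_fin_fun]
    exact le_antisymm G.rank_le_height hrank
  have hGc : IsUnit (G.map (algebraMap ℝ ℂ)) := hunit.map (algebraMap ℝ ℂ).mapMatrix
  obtain ⟨e, he⟩ : ∃ e : (Fin 3 → ℂ) ≃ₗ[ℂ] (Fin 3 → ℂ), ∀ w, e w = G.map (algebraMap ℝ ℂ) *ᵥ w :=
    ⟨LinearEquiv.ofBijective (G.map (algebraMap ℝ ℂ)).mulVecLin
      ⟨Matrix.mulVec_injective_iff_isUnit.2 hGc, Matrix.mulVec_surjective_iff_isUnit.2 hGc⟩,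
      fun _ => rfl⟩
  refine ⟨G⁻¹ * P.mat, e, 1, one_ne_zero, fun u => ?_, fun v => ?_⟩
  · rw [he, Matrix.mulVecLin_apply, Matrix.mulVec_mulVec, ← Matrix.map_mul,
      Matrix.mul_nonsing_inv_cancel_left _ _ ((Matrix.isUnit_iff_isUnit_det _).1 hunit)]
    rfl
  · rw [one_smul, he, Matrix.mulVecLin_apply, Matrix.mulVec_mulVec, ← Matrix.map_mul, ← hG]
    rfl

theorem exists_isUnit_forall_mulVec_eq_zero {Q : Fin 3 → Camera}
    (hQ : Projectivization.Independent (centers Q)) :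
    ∃ N : Matrix (Fin 4) (Fin 4) ℝ, IsUnit N ∧
      ∀ i x, (∀ j ≠ Fin.castSucc i, (N *ᵥ x) j = 0) → (Q i).mat *ᵥ x = 0 := by
  choose k hk hQk using fun i => (Q i).exists_real_center
  obtain ⟨w, hw⟩ := exists_linearIndependent_snoc_of_lt_finrank
    (linearIndependent_of_independent_centers hQ hk hQk) (by simp)
  let C : Matrix (Fin 4) (Fin 4) ℝ := Matrix.of (Fin.snoc k w)
  have hC : IsUnit Cᵀ :=
    (Matrix.isUnit_transpose _).2 (Matrix.linearIndependent_rows_iff_isUnit.1 hw)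
  refine ⟨Cᵀ⁻¹, Matrix.isUnit_nonsing_inv_iff.2 hC, fun i x hx => ?_⟩
  have hsum : x = ∑ j, (Cᵀ⁻¹ *ᵥ x) j • C j := by
    rw [← Matrix.vecMul_eq_sum, ← Matrix.mulVec_transpose, Matrix.mulVec_mulVec,
      Matrix.mul_nonsing_inv _ ((Matrix.isUnit_iff_isUnit_det _).1 hC), Matrix.one_mulVec]
  have hCi : C i.castSucc = k i := Fin.snoc_castSucc (α := fun _ => Fin 4 → ℝ) w k i
  rw [Finset.sum_eq_single_of_mem i.castSucc (Finset.mem_univ _) fun j _ hj => by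
    rw [hx j hj, zero_smul], hCi] at hsum
  rw [hsum, Matrix.mulVec_smul, hQk, smul_zero]

theorem exists_parametrizes_forall_mulVec_eq_zero {Q : Fin 3 → Camera}
    (hQ : Projectivization.Independent (centers Q)) :
    ∃ Y, Parametrizes Y (Pi.single 3 1) ∧
      ∀ i x, universalCamera i (Y *ᵥ x) = 0 → (Q i).mat *ᵥ x = 0 := by
  obtain ⟨N, hN, hzero⟩ := exists_isUnit_forall_mulVec_eq_zero hQ
  have hNc : Function.Injective (N.map (algebraMap ℝ ℂ)).mulVec :=
    Matrix.mulVec_injective_iff_isUnit.2 (hN.map (algebraMap ℝ ℂ).mapMatrix)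
  refine ⟨Matrix.of ![N 0, N 1, N 2, 0, N 3], Parametrizes.of_vecMul_eq_zero
    ((injective_iff_map_eq_zero _).2 fun u hu => hNc ?_) ?_ ?_,
    fun i x hx => hzero i x fun j hj => ?_⟩
  · rw [Matrix.mulVec_zero]
    ext j : 1
    fin_cases j
    exacts [congrFun hu 0, congrFun hu 1, congrFun hu 2, congrFun hu 4]
  · simp
  · rw [Matrix.single_one_vecMul]
    rfl
  · obtain ⟨h1, h2, h4⟩ := universalCamera_eq_zero_iff.1 hx
    have h3 : (Matrix.of ![N 0, N 1, N 2, 0, N 3] *ᵥ x) 3 = 0 := zero_dotProduct x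
    rw [h3, add_zero] at h2
    fin_cases i <;> fin_cases j <;> first | exact absurd rfl hj | assumption

end NormalizedCameras

section NormalForm

theorem universalCamera_comp_mulVecLin (i : Fin 3) (X : Matrix (Fin 5) (Fin 4) ℝ) :
    universalCamera i ∘ₗ (X.map (algebraMap ℝ ℂ)).mulVecLin =
      ((Matrix.of ![X (Fin.castAdd 2 (i + 1)), X (Fin.castAdd 2 (i + 2)) + X 3, X 4]).map
        (algebraMap ℝ ℂ)).mulVecLin := by
  ext u j
  fin_cases j
  exacts [rfl, (LinearMap.congr_fun (map_add complexForm _ _) _).symm, rfl]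

theorem exists_adapted_universalCamera (P : Fin 3 → Camera) {Q : Fin 3 → Camera}
    (hQ : Projectivization.Independent (centers Q)) :
    ∃ (Y : Matrix (Fin 5) (Fin 4) ℝ) (p : Fin 3 → Matrix (Fin 3) (Fin 4) ℝ),
      Parametrizes Y (Pi.single 3 1) ∧ ∀ i, Adapted (P i) (Q i)
        ((p i).map (algebraMap ℝ ℂ)).mulVecLin
        (universalCamera i ∘ₗ (Y.map (algebraMap ℝ ℂ)).mulVecLin) := by
  obtain ⟨Y, hY, hzero⟩ := exists_parametrizes_forall_mulVec_eq_zero hQ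
  have hzero' : ∀ i x, Matrix.of ![Y (Fin.castAdd 2 (i + 1)),
      Y (Fin.castAdd 2 (i + 2)) + Y 3, Y 4] *ᵥ x = 0 → (Q i).mat *ᵥ x = 0 := by
    intro i x hx
    refine hzero i x ?_
    rw [← hx]
    ext j
    fin_cases j
    exacts [rfl, (add_dotProduct _ _ x).symm, rfl]
  choose p hp using fun i => exists_adapted (P i) (Q i) (hzero' i)
  exact ⟨Y, p, hY, fun i => (universalCamera_comp_mulVecLin i Y).symm ▸ hp i⟩

theorem complexForm_single {k : ℕ} (j : Fin k) (ζ : Fin k → ℂ) :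
    complexForm (Pi.single j 1) ζ = ζ j := by
  simp [complexForm_apply, complexify_apply, dotProduct, Pi.single_apply,
    apply_ite ((↑) : ℝ → ℂ)]

theorem mk_mem_viewQuadric_iff_mul_eq_mul {P Q : Fin 3 → Camera} {Y : Matrix (Fin 5) (Fin 4) ℝ}
    {p : Fin 3 → Matrix (Fin 3) (Fin 4) ℝ} (hY : Parametrizes Y (Pi.single 3 1))
    (hp : ∀ i, Adapted (P i) (Q i) ((p i).map (algebraMap ℝ ℂ)).mulVecLin
      (universalCamera i ∘ₗ (Y.map (algebraMap ℝ ℂ)).mulVecLin))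
    {i : Fin 3} {u : Fin 4 → ℂ} (hu : u ≠ 0) :
    Projectivization.mk ℂ u hu ∈ viewQuadric P Q i (i + 1) ↔
      complexForm (p i 1) u * complexForm (p (i + 1) 2) u =
        complexForm (p i 2) u * complexForm (p (i + 1) 0) u := by
  rw [mk_mem_viewQuadric, (hp i).raysMeet_iff (hp (i + 1)), Matrix.mulVecLin_apply,
    Matrix.mulVecLin_apply]
  simp only [← map_mulVec_apply]
  rw [← exists_universalCamera_eq_smul_of_apply_three_iff]
  constructor
  · rintro ⟨w, a, b, hne, h⟩
    refine ⟨_, a, b, (complexForm_single _ _).symm.trans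
      (hY.exists_mulVec_eq_iff.1 ⟨w, rfl⟩), ?_, h⟩
    rwa [← Matrix.mulVecLin_apply, map_eq_zero_iff _ hY.injective]
  · rintro ⟨ζ, a, b, hζ, hne, h⟩
    obtain ⟨w, rfl⟩ := hY.exists_mulVec_eq_iff.2 ((complexForm_single _ _).trans hζ)
    refine ⟨w, a, b, ?_, h⟩
    rwa [← map_eq_zero_iff _ hY.injective, Matrix.mulVecLin_apply]

theorem exists_forall_eq_smul_of_complexForm_mem_span {ι : Type*} {k : ℕ} {w : ι → Fin k → ℝ}
    {φ : Module.Dual ℂ (Fin k → ℂ)} (hw : ∀ i, w i ≠ 0)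
    (hφ : ∀ i, complexForm (w i) ∈ Submodule.span ℂ {φ}) (i₀ : ι) :
    ∃ c : ι → ℝ, (∀ i, c i ≠ 0) ∧ ∀ i, w i = c i • w i₀ := by
  obtain ⟨z, hz⟩ := Submodule.mem_span_singleton.1 (hφ i₀)
  have hz0 : z ≠ 0 := by
    rintro rfl
    rw [zero_smul, eq_comm, map_eq_zero_iff _ complexForm_injective] at hz
    exact hw i₀ hz
  have hspan : ∀ i, w i ∈ Submodule.span ℝ {w i₀} := fun i => by
    refine mem_span_of_complexForm_mem_span ?_
    rw [← hz, Submodule.span_singleton_smul_eq hz0.isUnit]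
    exact hφ i
  choose c hc using fun i => Submodule.mem_span_singleton.1 (hspan i)
  refine ⟨c, fun i hi => hw i ?_, fun i => (hc i).symm⟩
  rw [← hc i, hi, zero_smul]

theorem exists_normalForm {a b : Module.Dual ℂ (Fin 4 → ℂ)} (hab : LinearIndependent ℂ ![a, b])
    {f g h : Fin 3 → Fin 4 → ℝ} {κ : Fin 3 → ℂ} (hκ : ∀ i, κ i ≠ 0) (hh : ∀ i, h i ≠ 0)
    (hspan : ∀ i, complexForm (h i) ∈ Submodule.span ℂ {a})
    (H : ∀ i u, complexForm (g i) u * complexForm (h (i + 1)) u -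
      complexForm (h i) u * complexForm (f (i + 1)) u = κ i * (a u * b u)) :
    ∃ (μ ν : Fin 3 → ℝ) (A B : Fin 4 → ℝ), (∀ i, μ i ≠ 0) ∧ (∀ i, ν i ≠ 0) ∧
      LinearIndependent ℝ ![A, B] ∧ ∀ i, h i = μ i • B ∧
        μ (i + 1) • g i - μ i • f (i + 1) = ν i • A := by
  obtain ⟨μ, hμ, hμB⟩ := exists_forall_eq_smul_of_complexForm_mem_span hh hspan 0
  obtain ⟨z, hz⟩ := Submodule.mem_span_singleton.1 (hspan 0)
  have hz0 : z ≠ 0 := by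
    rintro rfl
    rw [zero_smul, eq_comm, map_eq_zero_iff _ complexForm_injective] at hz
    exact hh 0 hz
  set D : Fin 3 → Fin 4 → ℝ := fun i => μ (i + 1) • g i - μ i • f (i + 1) with hD
  have hDb : ∀ i, complexForm (D i) = (z⁻¹ * κ i) • b := fun i => by
    have hmul : ∀ u, a u * (complexForm (D i) - (z⁻¹ * κ i) • b) u = 0 := fun u => by
      have hi := H i u
      simp only [hμB i, hμB (i + 1), complexForm_smul, ← hz, LinearMap.smul_apply,
        smul_eq_mul] at hi
      simp only [hD, map_sub, complexForm_smul, LinearMap.sub_apply, LinearMap.smul_apply,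
        smul_eq_mul]
      grind
    refine sub_eq_zero.1 (LinearMap.ext fun u => ?_)
    exact ((forall_eq_zero_or_of_mul_eq_zero ⊤ fun u _ => hmul u).resolve_left fun ha =>
      hab.ne_zero 0 (LinearMap.ext fun u => ha u trivial)) u trivial
  have hD0 : ∀ i, D i ≠ 0 := fun i hi => by
    have hi' := hDb i
    rw [hi, map_zero, eq_comm, smul_eq_zero] at hi'
    exact hi'.elim (mul_ne_zero (inv_ne_zero hz0) (hκ i)) (hab.ne_zero 1)
  obtain ⟨ν, hν, hνA⟩ := exists_forall_eq_smul_of_complexForm_mem_span (φ := b) hD0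
    (fun i => hDb i ▸ Submodule.smul_mem _ _ (Submodule.mem_span_singleton_self b)) 0
  refine ⟨μ, ν, D 0, h 0, hμ, hν, ?_, fun i => ⟨hμB i, hνA i⟩⟩
  refine LinearIndependent.pair_iff.2 fun c d hcd => ?_
  have hcd' := congrArg complexForm hcd
  rw [map_add, complexForm_smul, complexForm_smul, hDb, ← hz, smul_smul, smul_smul, map_zero,
    add_comm] at hcd'
  obtain ⟨hd, hc⟩ := LinearIndependent.pair_iff.1 hab _ _ hcd'
  simpa [hz0, hκ] using And.intro hc hd

theorem exists_rows_of_normalForm {V : Type*} [AddCommGroup V] [Module ℝ V] {A : V}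
    {f g : Fin 3 → V} {μ ν : Fin 3 → ℝ} (hμ : ∀ i, μ i ≠ 0) (hν : ∀ i, ν i ≠ 0)
    (H : ∀ i, μ (i + 1) • g i - μ i • f (i + 1) = ν i • A) :
    ∃ (l : Fin 3 → ℝ) (x : Fin 3 → V), (∀ i, l i ≠ 0) ∧ ∀ i,
      l (i + 1) • f i = μ i • x (i + 1) ∧ l (i + 2) • g i = μ i • (x (i + 2) + A) := by
  refine ⟨fun j => μ (j + 1) * μ (j + 2) / ν (j + 1), fun j => (μ (j + 1) / ν (j + 1)) • f (j + 2),
    fun j => div_ne_zero (mul_ne_zero (hμ _) (hμ _)) (hν _), fun i => ⟨?_, ?_⟩⟩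
  · simp only [show i + 1 + 2 = i by lia]
    module
  · simp only [show i + 2 + 1 = i by lia, show i + 2 + 2 = i + 1 by lia]
    calc (μ i * μ (i + 1) / ν i) • g i = (μ i / ν i) • μ (i + 1) • g i := by module
      _ = (μ i / ν i) • (ν i • A + μ i • f (i + 1)) := by rw [← H i, sub_add_cancel]
      _ = μ i • ((μ i / ν i) • f (i + 1) + A) := by
        match_scalars <;> field_simp [hν i]

end NormalForm

section Construction

variable {P Q : Fin 3 → Camera}

theorem Adapted.of_forall_eq_smul {P Q : Camera} {p q p' q' : Matrix (Fin 3) (Fin 4) ℝ}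
    (h : Adapted P Q (p.map (algebraMap ℝ ℂ)).mulVecLin (q.map (algebraMap ℝ ℂ)).mulVecLin)
    {c : ℝ} (hc : c ≠ 0) {d : Fin 3 → ℝ} (hd : ∀ j, d j ≠ 0) (hp : ∀ j, p j = d j • p' j)
    (hq : ∀ j, q j = c • d j • q' j) :
    Adapted P Q (p'.map (algebraMap ℝ ℂ)).mulVecLin (q'.map (algebraMap ℝ ℂ)).mulVecLin := by
  refine h.of_comp (LinearEquiv.piCongrRight fun j =>
    LinearEquiv.smulOfNeZero ℂ ℂ (d j : ℂ) (Complex.ofReal_ne_zero.2 (hd j)))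
    (Complex.ofReal_ne_zero.2 hc) (fun u => funext fun j => ?_) fun v => funext fun j => ?_
  · rw [Matrix.mulVecLin_apply, map_mulVec_apply, hp, complexForm_smul]
    rfl
  · rw [Matrix.mulVecLin_apply, map_mulVec_apply, hq, complexForm_smul, complexForm_smul]
    rfl

namespace Parametrizes

variable {Y : Matrix (Fin 5) (Fin 4) ℝ} {k : Fin 5}

theorem apply_eq_zero (h : Parametrizes Y (Pi.single k 1)) : Y k = 0 := by
  refine (map_eq_zero_iff _ complexForm_injective).1 (LinearMap.ext fun u => ?_)
  rw [← map_mulVec_apply, LinearMap.zero_apply]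
  exact (complexForm_single _ _).symm.trans (h.exists_mulVec_eq_iff.1 ⟨u, rfl⟩)

theorem smul_rows (h : Parametrizes Y (Pi.single k 1)) {d : Fin 5 → ℝ} (hd : ∀ j, d j ≠ 0) :
    Parametrizes (Matrix.of fun j => d j • Y j) (Pi.single k 1) := by
  refine of_vecMul_eq_zero ((injective_iff_map_eq_zero _).2 fun u hu => ?_) (by simp) ?_
  · refine (map_eq_zero_iff _ h.injective).1 (funext fun j => ?_)
    have hj : complexForm (d j • Y j) u = 0 := congrFun hu j
    rw [complexForm_smul, LinearMap.smul_apply, smul_eq_zero] at hj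
    exact hj.resolve_left (Complex.ofReal_ne_zero.2 (hd j))
  · rw [Matrix.single_one_vecMul]
    exact (congrArg (d k • ·) h.apply_eq_zero).trans (smul_zero _)

end Parametrizes

theorem injective_of_adapted_comp {p : Fin 3 → (Fin 5 → ℂ) →ₗ[ℂ] (Fin 3 → ℂ)}
    {q : Fin 3 → (Fin 4 → ℂ) →ₗ[ℂ] (Fin 3 → ℂ)} {X : (Fin 4 → ℂ) →ₗ[ℂ] (Fin 5 → ℂ)}
    (hP : Function.Injective (centers P)) (h : ∀ i, Adapted (P i) (Q i) (p i ∘ₗ X) (q i)) :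
    Function.Injective X := by
  refine (injective_iff_map_eq_zero _).2 fun u hXu => by_contra fun hu => ?_
  have hcenter : ∀ i, centers P i = Projectivization.mk ℂ u hu := fun i => by
    rw [centers, Camera.center_eq_mk_iff, (h i).toLin_eq_zero_iff, LinearMap.comp_apply, hXu,
      map_zero]
  exact absurd (hP ((hcenter 0).trans (hcenter 1).symm)) (by decide)

theorem linearIndependent_of_vecMul {F m n : Type*} [Field F] [Fintype m] {X : Matrix m n F}
    {r s t : m → F} (hr : r ≠ 0) (hrX : r ᵥ* X = 0)
    (hli : LinearIndependent F ![s ᵥ* X, t ᵥ* X]) : LinearIndependent F ![r, s, t] := by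
  refine Fintype.linearIndependent_iff.2 fun c hc => ?_
  simp only [Fin.sum_univ_three, Matrix.cons_val] at hc
  have hcX := congrArg (· ᵥ* X) hc
  simp only [Matrix.add_vecMul, Matrix.smul_vecMul, hrX, smul_zero, zero_add,
    Matrix.zero_vecMul] at hcX
  obtain ⟨h1, h2⟩ := LinearIndependent.pair_iff.1 hli _ _ hcX
  simp only [h1, h2, zero_smul, add_zero, smul_eq_zero, hr, or_false] at hc
  exact Fin.forall_fin_succ.2 ⟨hc, Fin.forall_fin_two.2 ⟨h1, h2⟩⟩

theorem adapted_append {Y : Matrix (Fin 5) (Fin 4) ℝ} {p : Matrix (Fin 3) (Fin 4) ℝ}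
    {P Q : Camera} {i : Fin 3}
    (hp : Adapted P Q (p.map (algebraMap ℝ ℂ)).mulVecLin
      (universalCamera i ∘ₗ (Y.map (algebraMap ℝ ℂ)).mulVecLin))
    (hY : Y 3 = 0) {l : Fin 3 → ℝ} (hl : ∀ i, l i ≠ 0) {μ : ℝ} (hμ : μ ≠ 0)
    {x : Fin 3 → Fin 4 → ℝ} {A B : Fin 4 → ℝ} (h0 : l (i + 1) • p 0 = μ • x (i + 1))
    (h1 : l (i + 2) • p 1 = μ • (x (i + 2) + A)) (h2 : p 2 = μ • B) :
    Adapted P Q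
      (universalCamera i ∘ₗ ((Matrix.of (Fin.append x ![A, B])).map (algebraMap ℝ ℂ)).mulVecLin)
      (universalCamera i ∘ₗ ((Matrix.of fun j =>
        Fin.append l (1 : Fin 2 → ℝ) j • Y j).map (algebraMap ℝ ℂ)).mulVecLin) := by
  rw [universalCamera_comp_mulVecLin] at hp ⊢
  rw [universalCamera_comp_mulVecLin]
  have hcancel : ∀ {c : ℝ} (v : Fin 4 → ℝ), c ≠ 0 → μ⁻¹ • (μ / c) • c • v = v := fun v hc => by
    rw [smul_smul, smul_smul, mul_assoc, div_mul_cancel₀ _ hc, inv_mul_cancel₀ hμ, one_smul]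
  have hdiv : ∀ {c : ℝ} {v w : Fin 4 → ℝ}, c ≠ 0 → c • v = μ • w → v = (μ / c) • w :=
    fun hc hvw => by rw [div_eq_inv_mul, mul_smul, ← hvw, inv_smul_smul₀ hc]
  refine hp.of_forall_eq_smul (inv_ne_zero hμ) (d := ![μ / l (i + 1), μ / l (i + 2), μ / 1])
    (Fin.forall_fin_succ.2 ⟨div_ne_zero hμ (hl _), Fin.forall_fin_two.2
      ⟨div_ne_zero hμ (hl _), div_ne_zero hμ one_ne_zero⟩⟩)
    (Fin.forall_fin_succ.2 ⟨?_, Fin.forall_fin_two.2 ⟨?_, ?_⟩⟩)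
    (Fin.forall_fin_succ.2 ⟨?_, Fin.forall_fin_two.2 ⟨?_, ?_⟩⟩)
  · change p 0 = (μ / l (i + 1)) • Fin.append x ![A, B] (Fin.castAdd 2 (i + 1))
    rw [Fin.append_left, hdiv (hl _) h0]
  · change p 1 = (μ / l (i + 2)) • (Fin.append x ![A, B] (Fin.castAdd 2 (i + 2)) + A)
    rw [Fin.append_left, hdiv (hl _) h1]
  · exact hdiv one_ne_zero ((one_smul ℝ _).trans h2)
  · change Y _ = μ⁻¹ • (μ / l (i + 1)) • Fin.append l (1 : Fin 2 → ℝ) (Fin.castAdd 2 _) • Y _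
    rw [Fin.append_left, hcancel _ (hl _)]
  · change Y _ + Y 3 = μ⁻¹ • (μ / l (i + 2)) •
      (Fin.append l (1 : Fin 2 → ℝ) (Fin.castAdd 2 _) • Y _ +
        Fin.append l (1 : Fin 2 → ℝ) 3 • Y 3)
    rw [Fin.append_left, hY, smul_zero, add_zero, add_zero, hcancel _ (hl _)]
  · exact (hcancel _ one_ne_zero).symm

theorem nonempty_commonLift_of_normalForm {Y : Matrix (Fin 5) (Fin 4) ℝ}
    {p : Fin 3 → Matrix (Fin 3) (Fin 4) ℝ} (hP : Function.Injective (centers P))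
    (hY : Parametrizes Y (Pi.single 3 1))
    (hp : ∀ i, Adapted (P i) (Q i) ((p i).map (algebraMap ℝ ℂ)).mulVecLin
      (universalCamera i ∘ₗ (Y.map (algebraMap ℝ ℂ)).mulVecLin))
    {μ ν : Fin 3 → ℝ} {A B : Fin 4 → ℝ} (hμ : ∀ i, μ i ≠ 0) (hν : ∀ i, ν i ≠ 0)
    (hAB : LinearIndependent ℝ ![A, B]) (hB : ∀ i, p i 2 = μ i • B)
    (hA : ∀ i, μ (i + 1) • p i 1 - μ i • p (i + 1) 0 = ν i • A) : Nonempty (CommonLift P Q) := by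
  obtain ⟨l, x, hl, hx⟩ := exists_rows_of_normalForm (f := fun i => p i 0) hμ hν hA
  have hadapted := fun i =>
    adapted_append (hp i) hY.apply_eq_zero hl (hμ i) (hx i).1 (hx i).2 (hB i)
  set X : Matrix (Fin 5) (Fin 4) ℝ := Matrix.of (Fin.append x ![A, B])
  have hX := injective_of_adapted_comp hP hadapted
  obtain ⟨r, hrX, hr⟩ := (Submodule.ne_bot_iff _).1
    (LinearMap.ker_ne_bot_of_finrank_lt (f := X.vecMulLinear) (by simp))
  have hd : ∀ j, Fin.append l (1 : Fin 2 → ℝ) j ≠ 0 := fun j =>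
    j.addCases (m := 3) (fun i => by simpa only [Fin.append_left] using hl i)
      fun i => by simpa only [Fin.append_right, Pi.one_apply] using one_ne_zero' ℝ
  exact ⟨{
    X := X
    Y := _
    r := r
    s := Pi.single 3 1
    parametrizes_X := .of_vecMul_eq_zero hX hr hrX
    parametrizes_Y := hY.smul_rows hd
    linearIndependent := linearIndependent_of_vecMul hr hrX (by
      rwa [Matrix.single_one_vecMul, Matrix.single_one_vecMul])
    adapted := hadapted }⟩

theorem linearIndependent_complexForm_of_surjective {p : Matrix (Fin 3) (Fin 4) ℝ}
    (hp : Function.Surjective (p.map (algebraMap ℝ ℂ)).mulVecLin) :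
    LinearIndependent ℂ ![complexForm (p 0), complexForm (p 1), complexForm (p 2)] := by
  refine Fintype.linearIndependent_iff.2 fun c hc j => ?_
  obtain ⟨u, hu⟩ := hp (Pi.single j 1)
  have hpu : ∀ k, complexForm (p k) u = (Pi.single j 1 : Fin 3 → ℂ) k := fun k => congrFun hu k
  have hcu := LinearMap.congr_fun hc u
  rw [Fin.sum_univ_three] at hcu
  change c 0 * complexForm (p 0) u + c 1 * complexForm (p 1) u + c 2 * complexForm (p 2) u = 0
    at hcu
  simp only [hpu] at hcu
  fin_cases j <;> simpa using hcu

theorem exists_mul_sub_mul_eq_mul {Y : Matrix (Fin 5) (Fin 4) ℝ}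
    {p : Fin 3 → Matrix (Fin 3) (Fin 4) ℝ} (hY : Parametrizes Y (Pi.single 3 1))
    (hp : ∀ i, Adapted (P i) (Q i) ((p i).map (algebraMap ℝ ℂ)).mulVecLin
      (universalCamera i ∘ₗ (Y.map (algebraMap ℝ ℂ)).mulVecLin))
    {a b : Fin 4 → ℂ} (hab : LinearIndependent ℂ ![dotProductEquiv ℂ _ a, dotProductEquiv ℂ _ b])
    {i : Fin 3} (h : viewQuadric P Q i (i + 1) = planeLocus a ∪ planeLocus b) :
    ∃ κ : ℂ, κ ≠ 0 ∧ ∀ u, complexForm (p i 1) u * complexForm (p (i + 1) 2) u -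
      complexForm (p i 2) u * complexForm (p (i + 1) 0) u =
        κ * (dotProductEquiv ℂ _ a u * dotProductEquiv ℂ _ b u) := by
  refine exists_eq_mul_of_eq_zero_iff
    (QuadraticMap.linMulLin (complexForm (p i 1)) (complexForm (p (i + 1) 2)) -
      QuadraticMap.linMulLin (complexForm (p i 2)) (complexForm (p (i + 1) 0))) hab fun u => ?_
  obtain rfl | hu := eq_or_ne u 0
  · simp only [map_zero, true_or]
  · rw [sub_apply, sub_eq_zero, QuadraticMap.linMulLin_apply,
      QuadraticMap.linMulLin_apply, ← mk_mem_viewQuadric_iff_mul_eq_mul hY hp hu, h, Set.mem_union,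
      mk_mem_planeLocus, mk_mem_planeLocus]
    rfl

theorem nonempty_commonLift (hP : Function.Injective (centers P))
    (hQ : Projectivization.Independent (centers Q)) {a b : Fin 4 → ℂ}
    (hab : LinearIndependent ℂ ![a, b])
    (h : ∀ i, viewQuadric P Q i (i + 1) = planeLocus a ∪ planeLocus b) :
    Nonempty (CommonLift P Q) := by
  obtain ⟨Y, p, hY, hp⟩ := exists_adapted_universalCamera P hQ
  have hli : LinearIndependent ℂ ![dotProductEquiv ℂ _ a, dotProductEquiv ℂ _ b] := by
    have hli := hab.map' (dotProductEquiv ℂ (Fin 4)).toLinearMap (dotProductEquiv ℂ (Fin 4)).ker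
    rwa [LinearEquiv.coe_coe, ← FinVec.map_eq] at hli
  choose κ hκ H using fun i => exists_mul_sub_mul_eq_mul hY hp hli (h i)
  have hlip := fun i => linearIndependent_complexForm_of_surjective (hp i).surjective
  have hh : ∀ i, p i 2 ≠ 0 := fun i hi => (hlip i).ne_zero 2 (by simp [hi])
  obtain hspan | hspan := forall_mem_span_singleton_of_cyclic
    (f := fun i => complexForm (p i 0)) (g := fun i => complexForm (p i 1))
    (h := fun i => complexForm (p i 2)) (hli.ne_zero 0) (hli.ne_zero 1) hlip hκ H
  · obtain ⟨μ, ν, A, B, hμ, hν, hAB, hnormal⟩ := exists_normalForm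
      (f := fun i => p i 0) (g := fun i => p i 1) hli hκ hh hspan H
    exact nonempty_commonLift_of_normalForm hP hY hp hμ hν hAB (fun i => (hnormal i).1)
      fun i => (hnormal i).2
  · obtain ⟨μ, ν, A, B, hμ, hν, hAB, hnormal⟩ := exists_normalForm
      (f := fun i => p i 0) (g := fun i => p i 1) (LinearIndependent.pair_symm_iff.1 hli) hκ hh
      hspan fun i u => (H i u).trans (congrArg _ (mul_comm _ _))
    exact nonempty_commonLift_of_normalForm hP hY hp hμ hν hAB (fun i => (hnormal i).1)
      fun i => (hnormal i).2

end Construction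

theorem mainTheorem6 :
    -- three views, all three quadrics equal to the same two planes
    (∀ P Q : Fin 3 → Camera,
      Function.Injective (centers P) → Function.Injective (centers Q) →
      Projectivization.Independent (centers Q) →
      ∀ a b : Fin 4 → ℂ, LinearIndependent ℂ ![a, b] →
      (∀ i j, i ≠ j → viewQuadric P Q i j = planeLocus a ∪ planeLocus b) →
      (∃ T : PlaneConic, T.IsProper ∧
        T.plane ∪ T.conicPlane = planeLocus a ∪ planeLocus b ∧
        (∀ i, centers P i ∈ T.conic) ∧
        (Projectivization.Independent (centers P) → T.IsSmooth) ∧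
        criticalPoints P Q = T.carrier) ∧
      (∃ T' : PlaneConic, T'.IsProper ∧
        (∀ i j, i ≠ j → viewQuadric Q P i j = T'.plane ∪ T'.conicPlane) ∧
        (∀ i, centers Q i ∈ T'.conic) ∧
        T'.IsSmooth ∧
        criticalPoints Q P = T'.carrier)) ∧
    -- the converse, for any number of views
    (∀ n : ℕ, 2 ≤ n → ∀ P : Fin n → Camera, Function.Injective (centers P) →
      ∀ T : PlaneConic, T.IsSmooth → (∀ i, centers P i ∈ T.conic) →
      (∀ X : Set P3, X ⊆ T.carrier → IsCritical P X) ∧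
      ∃ (Q : Fin n → Camera) (T' : PlaneConic),
        Function.Injective (centers Q) ∧
        T'.IsSmooth ∧ (T'.IsProper ↔ T.IsProper) ∧
        (∀ i, centers Q i ∈ T'.conic) ∧
        IsConjugate P T.carrier Q T'.carrier ∧
        ∀ X : Set P3, X ⊆ T.carrier →
          ∃ Y : Set P3, Y ⊆ T'.carrier ∧ IsConjugate P X Q Y) := by
  constructor
  · intro P Q hP _ hQind a b hab hquad
    obtain ⟨L⟩ := nonempty_commonLift hP hQind hab fun i => hquad i (i + 1) (by simp)
    refine ⟨⟨L.planeConic, L.isProper_planeConic, ?_, L.centers_mem_conic, L.isSmooth_planeConic,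
      L.criticalPoints_eq⟩, L.symm.planeConic, L.symm.isProper_planeConic,
      fun i j hij => L.symm.viewQuadric_eq hij, L.symm.centers_mem_conic,
      L.symm.isSmooth_planeConic hQind, L.symm.criticalPoints_eq⟩
    rw [← L.viewQuadric_eq zero_ne_one, hquad 0 1 zero_ne_one]
  · intro n hn P hP T hT hc
    obtain ⟨Q, T', hQ, hT', hproper, hcQ, hconj, hsub⟩ := exists_conjugate_of_isSmooth hn hP hT hc
    refine ⟨fun X hX => ?_, Q, T', hQ, hT', hproper, hcQ, hconj, hsub⟩
    obtain ⟨Y, -, hXY⟩ := hsub X hX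
    exact ⟨Q, Y, hQ, hXY⟩
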